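/- For a non-negative integer $n$ let $b_4(n)$ be the number of $4$-regular partitions of $n$, that is, of partitions of $n$ none of whose parts is divisible by $4$ (with $b_4(0)=1$). For a complex number $q$ with $|q|<1$ and a positive integer $n$ put $E_n:=(q^n;q^n)_\infty=\prod_{k=0}^{\infty}\bigl(1-q^{n}(q^{n})^{k}\bigr)$. Then, for every complex $q$ with $|q|<1$, the series below converges and $$\sum_{n=0}^{\infty} b_4(5n+3)\,q^n = 3\,\frac{E_2^2E_{10}^6}{E_1^5E_4E_{20}^2} + q\,\frac{E_2^4E_5^5E_{20}^3}{E_1^6E_4^2E_{10}^4} + 4q^2\,\frac{E_2^3E_{10}E_{20}^3}{E_1^5E_4^2}.$$ -/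

import Mathlib

/-- The infinite `q`-product `(a; q)_∞ = ∏_{k ≥ 0} (1 - a q^k)`, for complex `a` and `‖q‖ < 1`. -/
noncomputable def qProd (a q : ℂ) : ℂ := ∏' k : ℕ, (1 - a * q ^ k)

/-- For `‖q‖ < 1` the product defining `(a; q)_∞` converges (absolutely). -/
theorem multipliable_qProd (a : ℂ) {q : ℂ} (hq : ‖q‖ < 1) :
    Multipliable fun k : ℕ => (1 - a * q ^ k) := by
  have h : Summable fun k : ℕ => ‖-(a * q ^ k)‖ := by
    simpa [norm_mul, norm_pow] using
      (summable_geometric_of_lt_one (norm_nonneg q) hq).mul_left ‖a‖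
  simpa [sub_eq_add_neg] using multipliable_one_add_of_summable h

/-- `E_n = (q^n; q^n)_∞`, for a positive integer `n` and `‖q‖ < 1`. -/
noncomputable def eulerE (n : ℕ) (q : ℂ) : ℂ := qProd (q ^ n) (q ^ n)

/-- `b_ℓ(n)`: the number of `ℓ`-regular partitions of `n`, that is, of the partitions of `n` none of
whose parts is divisible by `ℓ` (the empty partition of `0` is counted, so `b_ℓ(0) = 1`). -/
def numRegularPartitions (l n : ℕ) : ℕ :=
  (Nat.Partition.restricted n (fun i => ¬ l ∣ i)).card

/-! Write `φ(s) = f(s, s)` and `ψ(s) = f(s, s³)`; here `theta 1 1` is `φ` and `theta 1 0`, being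
`f(s, 1)`, is `2ψ`. The generating function of `b₄` is `F = E₄/E₁`, and `F(-s) = ψ(s)/φ(s)`
(`theta_quotient_eq`). Put `y = -q` and let `s` run over the fifth roots of `y`. Sorting exponents
modulo 5 gives `φ(s) = A + 2sB + 2s⁴C` and `ψ(s) = P + sQ + s³R`, with `A, B, C, P, Q, R` theta
functions of `y`. Comparing coefficients of powers of `s` in `φ(s)F(-s) = ψ(s)` is a 5 × 5 linear
system for the components of `F`. Cramer's rule yields the component in class 3 as a polynomial over
`∏ φ(s)`, the product over the five roots (`dissection_coefficient`, `dissectionNorm`).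

This quotient simplifies because the six components are dependent. Dissecting `ψ(s)² = φ(s)ψ(s²)`
and eliminating the components of `ψ(s²)` gives three polynomial relations (`theta_relations`).
Splitting `ℤ²` into cosets of `(2 + i)ℤ[i]` gives `φ(y)² = A² + 4yBC` and `ψ(y)² = PQ + yR²`. Modulo
the three relations (`dissection_identity`), the component times `A φ(y)² ψ(y)²` becomes `R(3A²PQ +
qA²R² + 4q²R²BC)`. The Jacobi triple product evaluates `A`, `R`, `BC`, `PQ`, `φ(y)`, `ψ(y)` as
quotients of Euler products, and the three terms of the theorem result. -/

open Filter Topology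

/-! ### Convergence and non-vanishing of `q`-products -/

theorem summable_norm_mul_pow (a : ℂ) {q : ℂ} (hq : ‖q‖ < 1) :
    Summable fun k : ℕ => ‖-(a * q ^ k)‖ := by
  simpa [norm_mul, norm_pow] using
    (summable_geometric_of_lt_one (norm_nonneg q) hq).mul_left ‖a‖

theorem qProd_ne_zero {a q : ℂ} (hq : ‖q‖ < 1) (h : ∀ k : ℕ, 1 - a * q ^ k ≠ 0) :
    qProd a q ≠ 0 := by
  have := tprod_one_add_ne_zero_of_summable (f := fun k : ℕ => -(a * q ^ k))
    (by simpa [sub_eq_add_neg] using h) (summable_norm_mul_pow a hq)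
  simpa [qProd, sub_eq_add_neg] using this

theorem one_sub_ne_zero_of_norm_lt_one {z : ℂ} (hz : ‖z‖ < 1) : 1 - z ≠ 0 := by
  intro h
  rw [sub_eq_zero] at h
  rw [← h] at hz
  simp at hz

theorem norm_pow_lt_one {q : ℂ} (hq : ‖q‖ < 1) {n : ℕ} (hn : n ≠ 0) : ‖q ^ n‖ < 1 := by
  rw [norm_pow]
  exact pow_lt_one₀ (norm_nonneg q) hq hn

theorem qProd_ne_zero_of_norm_lt_one {a q : ℂ} (ha : ‖a‖ < 1) (hq : ‖q‖ < 1) :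
    qProd a q ≠ 0 := by
  refine qProd_ne_zero hq fun k => one_sub_ne_zero_of_norm_lt_one ?_
  rw [norm_mul, norm_pow]
  calc ‖a‖ * ‖q‖ ^ k ≤ ‖a‖ * 1 := by
        gcongr
        exact pow_le_one₀ (norm_nonneg q) hq.le
    _ < 1 := by simpa using ha

theorem tendsto_prod_range_qProd (a : ℂ) {q : ℂ} (hq : ‖q‖ < 1) :
    Tendsto (fun n : ℕ => ∏ k ∈ Finset.range n, (1 - a * q ^ k)) atTop (𝓝 (qProd a q)) :=
  (multipliable_qProd a hq).tendsto_prod_tprod_nat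

/-! ### Gaussian binomial coefficients -/

/-- The finite product `(x; x)_n`. -/
noncomputable def qFactor (x : ℂ) (n : ℕ) : ℂ := ∏ k ∈ Finset.range n, (1 - x * x ^ k)

theorem qFactor_succ (x : ℂ) (n : ℕ) : qFactor x (n + 1) = qFactor x n * (1 - x * x ^ n) := by
  simp [qFactor, Finset.prod_range_succ]

theorem qFactor_ne_zero {x : ℂ} (hx : ‖x‖ < 1) (n : ℕ) : qFactor x n ≠ 0 := by
  refine Finset.prod_ne_zero_iff.2 fun k _ => ?_
  rw [← pow_succ']
  exact one_sub_ne_zero_of_norm_lt_one (norm_pow_lt_one hx k.succ_ne_zero)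

/-- Gaussian binomial coefficients, defined by their Pascal recursion. -/
noncomputable def gaussBinom (x : ℂ) : ℕ → ℕ → ℂ
  | _, 0 => 1
  | 0, _ + 1 => 0
  | n + 1, k + 1 => gaussBinom x n k + x ^ (k + 1) * gaussBinom x n (k + 1)

theorem gaussBinom_zero_right (x : ℂ) (n : ℕ) : gaussBinom x n 0 = 1 := by
  cases n <;> rfl

theorem gaussBinom_succ_succ (x : ℂ) (n k : ℕ) :
    gaussBinom x (n + 1) (k + 1) = gaussBinom x n k + x ^ (k + 1) * gaussBinom x n (k + 1) := rfl

theorem gaussBinom_eq_zero (x : ℂ) : ∀ {n k : ℕ}, n < k → gaussBinom x n k = 0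
  | 0, k + 1, _ => rfl
  | n + 1, k + 1, h => by
    rw [gaussBinom_succ_succ, gaussBinom_eq_zero x (n := n) (by omega),
      gaussBinom_eq_zero x (n := n) (by omega)]
    simp

theorem gaussBinom_self (x : ℂ) : ∀ n : ℕ, gaussBinom x n n = 1
  | 0 => rfl
  | n + 1 => by
    rw [gaussBinom_succ_succ, gaussBinom_self x n, gaussBinom_eq_zero x (Nat.lt_succ_self n)]
    simp

/-- The factorial formula in cross-multiplied form, so that the induction needs neither division nor
`x` off the roots of unity. -/
theorem gaussBinom_mul (x : ℂ) (n : ℕ) : ∀ m k : ℕ, m + k = n →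
    gaussBinom x n k * (qFactor x k * qFactor x m) = qFactor x n := by
  induction n with
  | zero =>
    intro m k h
    obtain ⟨rfl, rfl⟩ : m = 0 ∧ k = 0 := by omega
    simp [gaussBinom_zero_right, qFactor]
  | succ n ih =>
    intro m k h
    rcases k with _ | k
    · obtain rfl : m = n + 1 := by omega
      simp [gaussBinom_zero_right, qFactor]
    · rcases m with _ | m
      · obtain rfl : n = k := by omega
        simp [gaussBinom_self, qFactor]
      · have h1 := ih (m + 1) k (by omega)
        have h2 := ih m (k + 1) (by omega)
        obtain rfl : n = m + k + 1 := by omega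
        rw [gaussBinom_succ_succ]
        rw [qFactor_succ x k] at h2 ⊢
        rw [qFactor_succ x m] at h1 ⊢
        rw [qFactor_succ x (m + k + 1)]
        linear_combination (1 - x * x ^ k) * h1 + x ^ (k + 1) * (1 - x * x ^ m) * h2

/-- The q-binomial theorem. Removing the factor `k = 0` leaves the same product at `y * x`, hence
the induction hypothesis must hold for every `y`. -/
theorem prod_one_add_eq_sum_gaussBinom (x : ℂ) (M : ℕ) : ∀ y : ℂ,
    ∏ k ∈ Finset.range M, (1 + y * x ^ k) =
      ∑ j ∈ Finset.range (M + 1), x ^ (j.choose 2) * gaussBinom x M j * y ^ j := by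
  induction M with
  | zero => simp [gaussBinom_zero_right]
  | succ M ih =>
    intro y
    have e : ∀ k : ℕ, 1 + y * x ^ (k + 1) = 1 + (y * x) * x ^ k := fun k => by ring
    rw [Finset.prod_range_succ']
    simp_rw [e]
    rw [ih, Finset.sum_range_succ' _ (M + 1)]
    have h1 : ∑ j ∈ Finset.range (M + 1), x ^ (j.choose 2) * gaussBinom x M j * (y * x) ^ j =
        1 + ∑ j ∈ Finset.range (M + 1),
          x ^ ((j + 1).choose 2) * gaussBinom x M (j + 1) * (y * x) ^ (j + 1) := by
      rw [← add_left_inj (x ^ ((M + 1).choose 2) * gaussBinom x M (M + 1) * (y * x) ^ (M + 1)),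
        ← Finset.sum_range_succ, Finset.sum_range_succ', gaussBinom_eq_zero x (Nat.lt_succ_self M)]
      simp [gaussBinom_zero_right, add_comm]
    have h2 : ∀ j : ℕ, x ^ ((j + 1).choose 2) * gaussBinom x (M + 1) (j + 1) * y ^ (j + 1) =
        y * (x ^ (j.choose 2) * gaussBinom x M j * (y * x) ^ j) +
          x ^ ((j + 1).choose 2) * gaussBinom x M (j + 1) * (y * x) ^ (j + 1) := by
      intro j
      rw [gaussBinom_succ_succ, Nat.choose_succ_succ' j 1, Nat.choose_one_right]
      ring
    simp_rw [h2]
    rw [Finset.sum_add_distrib, ← Finset.mul_sum]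
    simp only [Nat.choose_zero_succ, gaussBinom_zero_right, pow_zero, mul_one]
    linear_combination h1

/-! ### The Jacobi triple product -/

/-- The triangular numbers, over the integers. -/
def tri (n : ℤ) : ℤ := n * (n + 1) / 2

theorem two_mul_tri (n : ℤ) : 2 * tri n = n * (n + 1) :=
  Int.mul_ediv_cancel' (Int.even_mul_succ_self n).two_dvd

theorem tri_eq_of_two_mul {n m : ℤ} (h : n * (n + 1) = 2 * m) : tri n = m := by
  have := two_mul_tri n
  omega

theorem tri_natCast_sub_one (n : ℕ) : tri ((n : ℤ) - 1) = n.choose 2 := by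
  apply tri_eq_of_two_mul
  rcases n with _ | n
  · simp
  · have := Nat.triangle_succ n
    have h2 : ((n + 1).choose 2) * 2 = (n + 1) * n := by
      rw [Nat.choose_two_right]
      exact Nat.div_mul_cancel (by simpa [mul_comm] using (Nat.even_mul_succ_self n).two_dvd)
    have h3 : (((n + 1).choose 2 : ℕ) : ℤ) * 2 = (n + 1) * n := by exact_mod_cast h2
    push_cast
    linarith

/-- The general term of Jacobi's theta series. -/
noncomputable def thetaTerm (a x : ℂ) (n : ℤ) : ℂ := a ^ n * x ^ tri (n - 1)

theorem summable_norm_of_ratio {f : ℕ → ℂ} (hf : ∀ n, f n ≠ 0) {c q : ℂ} (hq : ‖q‖ < 1)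
    (h : ∀ n, f (n + 1) = c * q ^ n * f n) : Summable fun n => ‖f n‖ := by
  refine summable_of_ratio_test_tendsto_lt_one (l := 0) zero_lt_one
    (Eventually.of_forall fun n => norm_ne_zero_iff.2 (hf n)) ?_
  have h1 : ∀ n, ‖‖f (n + 1)‖‖ / ‖‖f n‖‖ = ‖c‖ * ‖q‖ ^ n := by
    intro n
    have := norm_ne_zero_iff.2 (hf n)
    rw [h n]
    simp only [norm_mul, norm_pow, norm_norm]
    field_simp
  simp_rw [h1]
  simpa using (tendsto_pow_atTop_nhds_zero_of_lt_one (norm_nonneg q) hq).const_mul ‖c‖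

theorem thetaTerm_ne_zero {a x : ℂ} (ha : a ≠ 0) (hx0 : x ≠ 0) (n : ℤ) : thetaTerm a x n ≠ 0 :=
  mul_ne_zero (zpow_ne_zero _ ha) (zpow_ne_zero _ hx0)

theorem summable_norm_thetaTerm {a x : ℂ} (ha : a ≠ 0) (hx0 : x ≠ 0) (hx : ‖x‖ < 1) :
    Summable fun n : ℤ => ‖thetaTerm a x n‖ := by
  refine Summable.of_nat_of_neg ?_ ?_
  · refine summable_norm_of_ratio (f := fun n : ℕ => thetaTerm a x n)
      (fun n => thetaTerm_ne_zero ha hx0 n) (c := a) hx fun n => ?_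
    have e : tri ((n : ℤ) + 1 - 1) = n + tri (n - 1) := by
      apply tri_eq_of_two_mul
      have := two_mul_tri ((n : ℤ) - 1)
      linear_combination (-1 : ℤ) * this
    simp only [thetaTerm]
    push_cast
    rw [e, zpow_add₀ ha, zpow_add₀ hx0]
    simp only [zpow_natCast, zpow_one]
    ring
  · refine summable_norm_of_ratio (f := fun n : ℕ => thetaTerm a x (-n))
      (fun n => thetaTerm_ne_zero ha hx0 _) (c := a⁻¹ * x) hx fun n => ?_
    have e : tri (-((n : ℤ) + 1) - 1) = n + 1 + tri (-n - 1) := by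
      apply tri_eq_of_two_mul
      have := two_mul_tri (-(n : ℤ) - 1)
      linear_combination (-1 : ℤ) * this
    simp only [thetaTerm]
    push_cast
    rw [e, neg_add, zpow_add₀ ha, zpow_add₀ hx0, zpow_add₀ hx0]
    simp only [zpow_natCast, zpow_one, zpow_neg]
    ring

theorem prod_mul_zpow_eq (a : ℂ) {x : ℂ} (hx0 : x ≠ 0) (N : ℕ) :
    ∏ j ∈ Finset.range N, a * x ^ (-(j : ℤ) - 1) = a ^ N * x ^ (-tri N) := by
  induction N with
  | zero => simp [tri]
  | succ n ih =>
    have e : -tri (n + 1) = -tri n + (-(n : ℤ) - 1) := by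
      have h1 := two_mul_tri n
      have h2 := two_mul_tri ((n : ℤ) + 1)
      have : 2 * tri (n + 1) = 2 * (tri n + n + 1) := by linear_combination h2 - h1
      omega
    rw [Finset.prod_range_succ, ih]
    push_cast
    rw [e, zpow_add₀ hx0, pow_succ]
    ring

/-- A finite triple product: the q-binomial theorem with `2N` factors, centred by `y = a x^(-N)`.
Each of the first `N` factors is `1 + a x^(-j-1) = a x^(-j-1) (1 + (x/a) x^j)`; the monomials are
cancelled at the end. -/
theorem prod_mul_prod_eq_sum_gaussBinom {a x : ℂ} (ha : a ≠ 0) (hx0 : x ≠ 0) (N : ℕ) :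
    (∏ k ∈ Finset.range N, (1 + a * x ^ k)) * ∏ k ∈ Finset.range N, (1 + x / a * x ^ k) =
      ∑ j ∈ Finset.range (2 * N + 1), gaussBinom x (2 * N) j * thetaTerm a x ((j : ℤ) - N) := by
  have h := prod_one_add_eq_sum_gaussBinom x (2 * N) (a * x ^ (-(N : ℤ)))
  rw [two_mul, Finset.prod_range_add, ← Finset.prod_range_reflect] at h
  have h1 : ∏ j ∈ Finset.range N, (1 + a * x ^ (-(N : ℤ)) * x ^ (N - 1 - j)) =
      (∏ j ∈ Finset.range N, a * x ^ (-(j : ℤ) - 1)) *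
        ∏ j ∈ Finset.range N, (1 + x / a * x ^ j) := by
    rw [← Finset.prod_mul_distrib]
    refine Finset.prod_congr rfl fun j hj => ?_
    have hj' := Finset.mem_range.1 hj
    have e1 : x ^ (N - 1 - j) = x ^ (N : ℤ) * x ^ (-(j : ℤ) - 1) := by
      rw [← zpow_add₀ hx0, ← zpow_natCast]
      congr 1
      omega
    have e2 : x ^ (-(j : ℤ) - 1) * (x * x ^ j) = 1 := by
      rw [← pow_succ', ← zpow_natCast, ← zpow_add₀ hx0]
      push_cast
      simp
    have e3 : x ^ (-(N : ℤ)) * x ^ (N : ℤ) = 1 := by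
      rw [← zpow_add₀ hx0]
      simp
    rw [e1]
    field_simp
    linear_combination a * x ^ (-(j : ℤ) - 1) * e3 - e2
  have h2 : ∀ k : ℕ, 1 + a * x ^ (-(N : ℤ)) * x ^ (N + k) = 1 + a * x ^ k := by
    intro k
    have e3 : x ^ (-(N : ℤ)) * x ^ N = 1 := by
      rw [← zpow_natCast, ← zpow_add₀ hx0]
      simp
    rw [pow_add]
    linear_combination a * x ^ k * e3
  rw [h1, prod_mul_zpow_eq a hx0] at h
  simp_rw [h2] at h
  have hc : a ^ N * x ^ (-tri N) ≠ 0 := mul_ne_zero (pow_ne_zero _ ha) (zpow_ne_zero _ hx0)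
  apply mul_left_cancel₀ hc
  rw [mul_comm (∏ k ∈ Finset.range N, (1 + a * x ^ k)), ← mul_assoc, h, ← two_mul,
    Finset.mul_sum]
  refine Finset.sum_congr rfl fun j _ => ?_
  have e1 : x ^ j.choose 2 * (a * x ^ (-(N : ℤ))) ^ j =
      a ^ N * x ^ (-tri N) * thetaTerm a x ((j : ℤ) - N) := by
    have e2 : (j.choose 2 : ℤ) + -(N : ℤ) * j = -tri N + tri ((j : ℤ) - N - 1) := by
      rw [← tri_natCast_sub_one]
      have h1 := two_mul_tri ((j : ℤ) - 1)
      have h2 := two_mul_tri N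
      have h3 := two_mul_tri ((j : ℤ) - N - 1)
      have : 2 * (tri ((j : ℤ) - 1) + -(N : ℤ) * j) = 2 * (-tri N + tri ((j : ℤ) - N - 1)) := by
        linear_combination h1 + h2 - h3
      omega
    rw [thetaTerm, mul_pow, ← zpow_natCast (x ^ (-(N : ℤ))), ← zpow_mul]
    calc x ^ j.choose 2 * (a ^ j * x ^ (-(N : ℤ) * j))
        = a ^ j * x ^ ((j.choose 2 : ℤ) + -(N : ℤ) * j) := by
          rw [zpow_add₀ hx0, zpow_natCast]; ring
      _ = _ := by
          rw [e2, zpow_add₀ hx0, zpow_sub₀ ha, zpow_natCast, zpow_natCast]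
          have := pow_ne_zero N ha
          field_simp
  linear_combination gaussBinom x (2 * N) j * e1

/-- `(x; x)_n` converges to a nonzero limit, so it and its inverse are bounded. The uniform bound is
the domination used for the triple product. -/
theorem exists_norm_gaussBinom_le {x : ℂ} (hx : ‖x‖ < 1) :
    ∃ K : ℝ, ∀ n k : ℕ, ‖gaussBinom x n k‖ ≤ K := by
  have ht : Tendsto (qFactor x) atTop (𝓝 (qProd x x)) := tendsto_prod_range_qProd x hx
  obtain ⟨K₁, hK₁⟩ := ht.norm.bddAbove_range
  obtain ⟨K₂, hK₂⟩ := (ht.inv₀ (qProd_ne_zero_of_norm_lt_one hx hx)).norm.bddAbove_range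
  have h1 : ∀ n, ‖qFactor x n‖ ≤ K₁ := fun n => hK₁ ⟨n, rfl⟩
  have h2 : ∀ n, ‖(qFactor x n)⁻¹‖ ≤ K₂ := fun n => hK₂ ⟨n, rfl⟩
  have p1 : 0 ≤ K₁ := (norm_nonneg _).trans (h1 0)
  have p2 : 0 ≤ K₂ := (norm_nonneg _).trans (h2 0)
  refine ⟨K₁ * (K₂ * K₂), fun n k => ?_⟩
  rcases lt_or_ge n k with h | h
  · rw [gaussBinom_eq_zero x h, norm_zero]
    positivity
  · have e : gaussBinom x n k = qFactor x n * ((qFactor x k)⁻¹ * (qFactor x (n - k))⁻¹) := by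
      have h3 := gaussBinom_mul x n (n - k) k (by omega)
      have := qFactor_ne_zero hx k
      have := qFactor_ne_zero hx (n - k)
      rw [← h3]
      field_simp
    rw [e, norm_mul, norm_mul]
    gcongr
    · exact h1 n
    · exact h2 k
    · exact h2 (n - k)

theorem tendsto_gaussBinom {x : ℂ} (hx : ‖x‖ < 1) (n : ℤ) :
    Tendsto (fun N : ℕ => gaussBinom x (2 * N) (n + N).toNat) atTop (𝓝 (qProd x x)⁻¹) := by
  have h0 := qProd_ne_zero_of_norm_lt_one hx hx
  have ht : Tendsto (qFactor x) atTop (𝓝 (qProd x x)) := tendsto_prod_range_qProd x hx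
  have t1 : Tendsto (fun N : ℕ => 2 * N) atTop atTop :=
    tendsto_atTop_mono (fun N => Nat.le_mul_of_pos_left N two_pos) tendsto_id
  have t2 : ∀ m : ℤ, Tendsto (fun N : ℕ => (m + N).toNat) atTop atTop := fun m =>
    tendsto_atTop.2 fun b => (eventually_ge_atTop (b + m.natAbs)).mono fun N hN => by omega
  have h := (ht.comp t1).mul
    (((ht.comp (t2 n)).inv₀ h0).mul ((ht.comp (t2 (-n))).inv₀ h0))
  have e : qProd x x * ((qProd x x)⁻¹ * (qProd x x)⁻¹) = (qProd x x)⁻¹ := by field_simp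
  rw [e] at h
  refine h.congr' ((eventually_ge_atTop n.natAbs).mono fun N hN => ?_)
  have h3 := gaussBinom_mul x (2 * N) (-n + N).toNat (n + N).toNat (by omega)
  have := qFactor_ne_zero hx (n + N).toNat
  have := qFactor_ne_zero hx (-n + N).toNat
  simp only [Function.comp]
  rw [← h3]
  field_simp

/-- The Jacobi triple product identity. -/
theorem tsum_thetaTerm {a x : ℂ} (ha : a ≠ 0) (hx0 : x ≠ 0) (hx : ‖x‖ < 1) :
    ∑' n : ℤ, thetaTerm a x n = qProd (-a) x * qProd (-(x / a)) x * qProd x x := by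
  obtain ⟨K, hK⟩ := exists_norm_gaussBinom_le hx
  -- The finite identity extended by zero to `ℤ`, so that `N → ∞` is dominated convergence; each
  -- Gaussian coefficient tends to `1/(x; x)_∞`.
  let g : ℕ → ℤ → ℂ := fun N n =>
    if n ∈ Finset.Icc (-(N : ℤ)) N then gaussBinom x (2 * N) (n + N).toNat * thetaTerm a x n else 0
  have hsum : ∀ N : ℕ, ∑' n, g N n =
      (∏ k ∈ Finset.range N, (1 - -a * x ^ k)) *
        ∏ k ∈ Finset.range N, (1 - -(x / a) * x ^ k) := by
    intro N
    simp only [neg_mul, sub_neg_eq_add]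
    rw [prod_mul_prod_eq_sum_gaussBinom ha hx0 N, tsum_eq_sum (s := Finset.Icc (-(N : ℤ)) N)
      (fun n hn => if_neg hn)]
    refine Finset.sum_bij' (fun n _ => (n + N).toNat) (fun j _ => (j : ℤ) - N) ?_ ?_ ?_ ?_ ?_
    · intro n hn
      simp only [Finset.mem_Icc, Finset.mem_range] at hn ⊢
      omega
    · intro j hj
      simp only [Finset.mem_Icc, Finset.mem_range] at hj ⊢
      omega
    · intro n hn
      simp only [Finset.mem_Icc] at hn
      omega
    · intro j hj
      omega
    · intro n hn
      have hn' := Finset.mem_Icc.1 hn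
      have e : (((n + N).toNat : ℕ) : ℤ) - N = n := by omega
      simp only [if_pos hn, e]
  have hlim : Tendsto (fun N => ∑' n, g N n) atTop
      (𝓝 (∑' n : ℤ, (qProd x x)⁻¹ * thetaTerm a x n)) := by
    refine tendsto_tsum_of_dominated_convergence (bound := fun n => K * ‖thetaTerm a x n‖)
      ((summable_norm_thetaTerm ha hx0 hx).mul_left K) ?_ ?_
    · intro n
      refine ((tendsto_gaussBinom hx n).mul_const _).congr'
        ((eventually_ge_atTop n.natAbs).mono fun N hN => ?_)
      have : n ∈ Finset.Icc (-(N : ℤ)) N := by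
        rw [Finset.mem_Icc]
        omega
      simp only [g, if_pos this]
    · refine Eventually.of_forall fun N n => ?_
      simp only [g]
      split_ifs
      · rw [norm_mul]
        gcongr
        exact hK _ _
      · rw [norm_zero]
        have := (norm_nonneg _).trans (hK 0 0)
        positivity
  simp_rw [hsum] at hlim
  have hlim' := (tendsto_prod_range_qProd (-a) hx).mul (tendsto_prod_range_qProd (-(x / a)) hx)
  have h := tendsto_nhds_unique hlim hlim'
  rw [tsum_mul_left] at h
  rw [← h]
  have h0 := qProd_ne_zero_of_norm_lt_one hx hx
  field_simp

/-! ### Theta functions and their dissections -/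

/-- Ramanujan's theta function `f(q^i, q^j)`. -/
noncomputable def theta (i j : ℕ) (q : ℂ) : ℂ := ∑' n : ℤ, q ^ ((i : ℤ) * tri n + j * tri (n - 1))

theorem theta_term_eq {q : ℂ} (hq0 : q ≠ 0) (i j : ℕ) (n : ℤ) :
    q ^ ((i : ℤ) * tri n + j * tri (n - 1)) = thetaTerm (q ^ i) (q ^ (i + j)) n := by
  have e : tri n = n + tri (n - 1) := by
    apply tri_eq_of_two_mul
    linear_combination (-1 : ℤ) * two_mul_tri (n - 1)
  rw [thetaTerm, ← zpow_natCast, ← zpow_natCast, ← zpow_mul, ← zpow_mul, ← zpow_add₀ hq0, e]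
  congr 1
  push_cast
  ring

theorem theta_eq_qProd {q : ℂ} (hq0 : q ≠ 0) (hq : ‖q‖ < 1) {i j : ℕ} (hij : i + j ≠ 0) :
    theta i j q =
      qProd (-q ^ i) (q ^ (i + j)) * qProd (-q ^ j) (q ^ (i + j)) *
        qProd (q ^ (i + j)) (q ^ (i + j)) := by
  unfold theta
  simp_rw [theta_term_eq hq0]
  rw [tsum_thetaTerm (pow_ne_zero _ hq0) (pow_ne_zero _ hq0) (norm_pow_lt_one hq hij), pow_add,
    mul_div_cancel_left₀ _ (pow_ne_zero _ hq0)]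

theorem summable_norm_theta {q : ℂ} (hq0 : q ≠ 0) (hq : ‖q‖ < 1) {i j : ℕ} (hij : i + j ≠ 0) :
    Summable fun n : ℤ => ‖q ^ ((i : ℤ) * tri n + j * tri (n - 1))‖ := by
  simp_rw [theta_term_eq hq0]
  exact summable_norm_thetaTerm (pow_ne_zero _ hq0) (pow_ne_zero _ hq0) (norm_pow_lt_one hq hij)

theorem theta_comm (i j : ℕ) (q : ℂ) : theta i j q = theta j i q := by
  unfold theta
  rw [← (Equiv.neg ℤ).tsum_eq]
  refine tsum_congr fun n => ?_
  have h1 : tri (-n) = tri (n - 1) := tri_eq_of_two_mul (by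
    linear_combination (-1 : ℤ) * two_mul_tri (n - 1))
  have h2 : tri (-n - 1) = tri n := tri_eq_of_two_mul (by
    linear_combination (-1 : ℤ) * two_mul_tri n)
  simp only [Equiv.neg_apply, h1, h2, add_comm]

theorem theta_pow (i j k : ℕ) (q : ℂ) : theta i j (q ^ k) = theta (k * i) (k * j) q := by
  unfold theta
  refine tsum_congr fun n => ?_
  rw [← zpow_natCast, ← zpow_mul]
  congr 1
  push_cast
  ring

/-- Recognises a series with quadratic exponent as a theta function, after shifting the index by `s`
and extracting `t ^ c`. The exponents are doubled so that `h` is a polynomial identity. -/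
theorem tsum_zpow_eq_theta {t : ℂ} (ht : t ≠ 0) {e : ℤ → ℤ} (i j k : ℕ) (c s : ℤ)
    (h : ∀ m, 2 * e m = 2 * c + k * (i * ((m + s) * (m + s + 1)) + j * ((m + s - 1) * (m + s)))) :
    ∑' m, t ^ e m = t ^ c * theta i j (t ^ k) := by
  unfold theta
  rw [← (Equiv.addRight s).tsum_eq fun n : ℤ => (t ^ k) ^ ((i : ℤ) * tri n + j * tri (n - 1)),
    ← tsum_mul_left]
  refine tsum_congr fun m => ?_
  simp only [Equiv.coe_addRight]
  rw [← zpow_natCast, ← zpow_mul, ← zpow_add₀ ht]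
  congr 1
  have h1 := two_mul_tri (m + s)
  have h2 := two_mul_tri (m + s - 1)
  have : 2 * e m = 2 * (c + k * (i * tri (m + s) + j * tri (m + s - 1))) := by
    linear_combination h m - k * i * h1 - k * j * h2
  omega

theorem tsum_prod_zpow_eq_theta {q : ℂ} (hq0 : q ≠ 0) (hq : ‖q‖ < 1) {e : ℤ → ℤ → ℤ}
    (i j k l : ℕ) (hij : i + j ≠ 0) (hkl : k + l ≠ 0) (c s s' : ℤ)
    (h : ∀ u v, 2 * e u v = 2 * c + (i * ((u + s) * (u + s + 1)) + j * ((u + s - 1) * (u + s))) +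
      (k * ((v + s') * (v + s' + 1)) + l * ((v + s' - 1) * (v + s')))) :
    ∑' p : ℤ × ℤ, q ^ e p.1 p.2 = q ^ c * (theta i j q * theta k l q) := by
  unfold theta
  rw [tsum_mul_tsum_of_summable_norm (summable_norm_theta hq0 hq hij)
    (summable_norm_theta hq0 hq hkl),
    ← ((Equiv.addRight s).prodCongr (Equiv.addRight s')).tsum_eq fun p : ℤ × ℤ =>
      q ^ ((i : ℤ) * tri p.1 + j * tri (p.1 - 1)) * q ^ ((k : ℤ) * tri p.2 + l * tri (p.2 - 1)),
    ← tsum_mul_left]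
  refine tsum_congr fun p => ?_
  simp only [Equiv.prodCongr_apply, Prod.map, Equiv.coe_addRight]
  rw [← zpow_add₀ hq0, ← zpow_add₀ hq0]
  congr 1
  have h1 := two_mul_tri (p.1 + s)
  have h2 := two_mul_tri (p.1 + s - 1)
  have h3 := two_mul_tri (p.2 + s')
  have h4 := two_mul_tri (p.2 + s' - 1)
  have := h p.1 p.2
  have : 2 * e p.1 p.2 = 2 * (c + (i * tri (p.1 + s) + j * tri (p.1 + s - 1) +
      (k * tri (p.2 + s') + l * tri (p.2 + s' - 1)))) := by
    linear_combination this - i * h1 - j * h2 - k * h3 - l * h4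
  omega

/-! ### Splitting sums over `ℤ` and `ℤ²` into five classes. -/

theorem tsum_int_eq_sum_mod_five {f : ℤ → ℂ} (hf : Summable f) :
    ∑' n, f n = (∑' m, f (5 * m)) + (∑' m, f (5 * m + 1)) + (∑' m, f (5 * m + 2)) +
      (∑' m, f (5 * m + 3)) + ∑' m, f (5 * m + 4) := by
  have e := (Int.divModEquiv 5).symm.tsum_eq f
  have hs := (Int.divModEquiv 5).symm.summable_iff.2 hf
  rw [← e, ← (Equiv.prodComm _ _).tsum_eq, Summable.tsum_prod, tsum_fintype, Fin.sum_univ_five]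
  · simp [Int.divModEquiv, mul_comm]
  · exact (Equiv.prodComm _ _).summable_iff.2 hs

/-- The bijection `(u, v, r) ↦ (2u + v + r, u - 2v)`, which realises `ℤ²` as five cosets of the
sublattice `(2 + i)ℤ[i]`. -/
def gaussianCosets : Fin 5 × (ℤ × ℤ) ≃ ℤ × ℤ where
  toFun p := (2 * p.2.1 + p.2.2 + (p.1 : ℕ), p.2.1 - 2 * p.2.2)
  invFun p := (⟨((p.1 - 2 * p.2) % 5).toNat, by omega⟩,
    (p.2 + 2 * ((p.1 - 2 * p.2) / 5), (p.1 - 2 * p.2) / 5))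
  left_inv := by
    rintro ⟨⟨r, hr⟩, u, v⟩
    ext <;> (simp; omega)
  right_inv := by
    rintro ⟨m, n⟩
    ext <;> simp
    omega

theorem tsum_prod_eq_sum_gaussianCosets {f : ℤ × ℤ → ℂ} (hf : Summable f) :
    ∑' p, f p = (∑' p : ℤ × ℤ, f (2 * p.1 + p.2, p.1 - 2 * p.2)) +
      (∑' p : ℤ × ℤ, f (2 * p.1 + p.2 + 1, p.1 - 2 * p.2)) +
      (∑' p : ℤ × ℤ, f (2 * p.1 + p.2 + 2, p.1 - 2 * p.2)) +
      (∑' p : ℤ × ℤ, f (2 * p.1 + p.2 + 3, p.1 - 2 * p.2)) +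
      ∑' p : ℤ × ℤ, f (2 * p.1 + p.2 + 4, p.1 - 2 * p.2) := by
  rw [← gaussianCosets.tsum_eq f, Summable.tsum_prod, tsum_fintype, Fin.sum_univ_five]
  · simp [gaussianCosets]
  · exact gaussianCosets.summable_iff.2 hf

/-- Hides the division in `tri`: the exponent is known only through its double, and `ring` settles
the dissections. -/
theorem exists_exponent_theta (i j : ℕ) (q : ℂ) : ∃ e : ℤ → ℤ,
    (∀ n, 2 * e n = i * (n * (n + 1)) + j * ((n - 1) * n)) ∧ theta i j q = ∑' n, q ^ e n ∧
    (q ≠ 0 → ‖q‖ < 1 → i + j ≠ 0 → Summable fun n => ‖q ^ e n‖) := by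
  refine ⟨fun n => i * tri n + j * tri (n - 1), fun n => ?_, rfl, fun h0 h1 h2 =>
    summable_norm_theta h0 h1 h2⟩
  linear_combination i * two_mul_tri n + j * two_mul_tri (n - 1)

theorem theta_one_one_dissection {t : ℂ} (ht0 : t ≠ 0) (ht : ‖t‖ < 1) :
    theta 1 1 t = theta 5 5 (t ^ 5) + 2 * t * theta 3 7 (t ^ 5) + 2 * t ^ 4 * theta 1 9 (t ^ 5) := by
  obtain ⟨e, he, hth, hs⟩ := exists_exponent_theta 1 1 t
  rw [hth, tsum_int_eq_sum_mod_five (hs ht0 ht (by norm_num)).of_norm,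
    tsum_zpow_eq_theta (e := fun m => e (5 * m)) ht0 5 5 5 0 0
      (fun m => by rw [he]; push_cast; ring),
    tsum_zpow_eq_theta (e := fun m => e (5 * m + 1)) ht0 7 3 5 1 0
      (fun m => by rw [he]; push_cast; ring),
    tsum_zpow_eq_theta (e := fun m => e (5 * m + 2)) ht0 9 1 5 4 0
      (fun m => by rw [he]; push_cast; ring),
    tsum_zpow_eq_theta (e := fun m => e (5 * m + 3)) ht0 1 9 5 4 1
      (fun m => by rw [he]; push_cast; ring),
    tsum_zpow_eq_theta (e := fun m => e (5 * m + 4)) ht0 3 7 5 1 1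
      (fun m => by rw [he]; push_cast; ring),
    theta_comm 7 3, theta_comm 9 1, zpow_zero, zpow_one,
    show (4 : ℤ) = (4 : ℕ) from rfl, zpow_natCast]
  ring

theorem theta_one_zero_dissection {t : ℂ} (ht0 : t ≠ 0) (ht : ‖t‖ < 1) :
    theta 1 0 t = 2 * theta 2 3 (t ^ 5) + 2 * t * theta 1 4 (t ^ 5) + t ^ 3 * theta 5 0 (t ^ 5) := by
  obtain ⟨e, he, hth, hs⟩ := exists_exponent_theta 1 0 t
  rw [hth, tsum_int_eq_sum_mod_five (hs ht0 ht (by norm_num)).of_norm,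
    tsum_zpow_eq_theta (e := fun m => e (5 * m)) ht0 3 2 5 0 0
      (fun m => by rw [he]; push_cast; ring),
    tsum_zpow_eq_theta (e := fun m => e (5 * m + 1)) ht0 4 1 5 1 0
      (fun m => by rw [he]; push_cast; ring),
    tsum_zpow_eq_theta (e := fun m => e (5 * m + 2)) ht0 5 0 5 3 0
      (fun m => by rw [he]; push_cast; ring),
    tsum_zpow_eq_theta (e := fun m => e (5 * m + 3)) ht0 1 4 5 1 1
      (fun m => by rw [he]; push_cast; ring),
    tsum_zpow_eq_theta (e := fun m => e (5 * m + 4)) ht0 2 3 5 0 1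
      (fun m => by rw [he]; push_cast; ring),
    theta_comm 3 2, theta_comm 4 1, zpow_zero, zpow_one,
    show (3 : ℤ) = (3 : ℕ) from rfl, zpow_natCast]
  ring

/-- With `m = 2u + v + r`, `n = u - 2v`, the cross terms in `m² + n²` cancel, leaving `5u² + 5v²`
plus linear terms. Each coset thus factors; `r = 0` gives the square and the other four agree. -/
theorem theta_one_one_sq {q : ℂ} (hq0 : q ≠ 0) (hq : ‖q‖ < 1) :
    theta 1 1 q ^ 2 = theta 5 5 q ^ 2 + 4 * q * (theta 3 7 q * theta 1 9 q) := by
  obtain ⟨e, he, hth, hs⟩ := exists_exponent_theta 1 1 q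
  have hs' := hs hq0 hq (by norm_num)
  have key := tsum_prod_eq_sum_gaussianCosets (summable_mul_of_summable_norm hs' hs')
  rw [← tsum_mul_tsum_of_summable_norm hs' hs', ← hth] at key
  simp only [← zpow_add₀ hq0] at key
  rw [tsum_prod_zpow_eq_theta (e := fun u v => e (2 * u + v) + e (u - 2 * v)) hq0 hq 5 5 5 5
      (by norm_num) (by norm_num) 0 0 0 (fun u v => by rw [mul_add 2, he, he]; push_cast; ring),
    tsum_prod_zpow_eq_theta (e := fun u v => e (2 * u + v + 1) + e (u - 2 * v)) hq0 hq 9 1 7 3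
      (by norm_num) (by norm_num) 1 0 0 (fun u v => by rw [mul_add 2, he, he]; push_cast; ring),
    tsum_prod_zpow_eq_theta (e := fun u v => e (2 * u + v + 2) + e (u - 2 * v)) hq0 hq 3 7 9 1
      (by norm_num) (by norm_num) 1 1 0 (fun u v => by rw [mul_add 2, he, he]; push_cast; ring),
    tsum_prod_zpow_eq_theta (e := fun u v => e (2 * u + v + 3) + e (u - 2 * v)) hq0 hq 7 3 1 9
      (by norm_num) (by norm_num) 1 1 1 (fun u v => by rw [mul_add 2, he, he]; push_cast; ring),
    tsum_prod_zpow_eq_theta (e := fun u v => e (2 * u + v + 4) + e (u - 2 * v)) hq0 hq 1 9 3 7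
      (by norm_num) (by norm_num) 1 2 1 (fun u v => by rw [mul_add 2, he, he]; push_cast; ring),
    theta_comm 7 3, theta_comm 9 1, zpow_zero, zpow_one] at key
  linear_combination key

/-- The same cosets for triangular numbers; now `r = 3` is the exceptional one. -/
theorem theta_one_zero_sq {q : ℂ} (hq0 : q ≠ 0) (hq : ‖q‖ < 1) :
    theta 1 0 q ^ 2 = 4 * (theta 2 3 q * theta 1 4 q) + q * theta 5 0 q ^ 2 := by
  obtain ⟨e, he, hth, hs⟩ := exists_exponent_theta 1 0 q
  have hs' := hs hq0 hq (by norm_num)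
  have key := tsum_prod_eq_sum_gaussianCosets (summable_mul_of_summable_norm hs' hs')
  rw [← tsum_mul_tsum_of_summable_norm hs' hs', ← hth] at key
  simp only [← zpow_add₀ hq0] at key
  rw [tsum_prod_zpow_eq_theta (e := fun u v => e (2 * u + v) + e (u - 2 * v)) hq0 hq 4 1 2 3
      (by norm_num) (by norm_num) 0 0 0 (fun u v => by rw [mul_add 2, he, he]; push_cast; ring),
    tsum_prod_zpow_eq_theta (e := fun u v => e (2 * u + v + 1) + e (u - 2 * v)) hq0 hq 1 4 3 2
      (by norm_num) (by norm_num) 0 1 0 (fun u v => by rw [mul_add 2, he, he]; push_cast; ring),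
    tsum_prod_zpow_eq_theta (e := fun u v => e (2 * u + v + 2) + e (u - 2 * v)) hq0 hq 3 2 4 1
      (by norm_num) (by norm_num) 0 1 0 (fun u v => by rw [mul_add 2, he, he]; push_cast; ring),
    tsum_prod_zpow_eq_theta (e := fun u v => e (2 * u + v + 3) + e (u - 2 * v)) hq0 hq 5 0 5 0
      (by norm_num) (by norm_num) 1 1 0 (fun u v => by rw [mul_add 2, he, he]; push_cast; ring),
    tsum_prod_zpow_eq_theta (e := fun u v => e (2 * u + v + 4) + e (u - 2 * v)) hq0 hq 2 3 1 4
      (by norm_num) (by norm_num) 0 2 1 (fun u v => by rw [mul_add 2, he, he]; push_cast; ring),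
    theta_comm 4 1, theta_comm 3 2, zpow_zero, zpow_one] at key
  linear_combination key

/-! ### Product identities -/

theorem qProd_eq_prod_fin (a : ℂ) {q : ℂ} (hq : ‖q‖ < 1) (m : ℕ) [NeZero m] :
    qProd a q = ∏ r : Fin m, qProd (a * q ^ (r : ℕ)) (q ^ m) := by
  have h := (multipliable_qProd a hq).hasProd
  rw [← (Nat.divModEquiv m).symm.hasProd_iff, ← (Equiv.prodComm _ _).hasProd_iff] at h
  have h1 := h.prod_fiberwise (g := fun r : Fin m => qProd (a * q ^ (r : ℕ)) (q ^ m)) fun r => by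
    have : HasProd _ (qProd (a * q ^ (r : ℕ)) (q ^ m)) :=
      (multipliable_qProd (a * q ^ (r : ℕ)) (norm_pow_lt_one hq (NeZero.ne m))).hasProd
    convert this using 1
    funext k
    simp only [Function.comp, Equiv.prodComm_apply, Prod.swap, Nat.divModEquiv_symm_apply]
    rw [pow_add, mul_comm k m, pow_mul]
    ring
  exact h1.unique (hasProd_fintype _) 

theorem qProd_mul_qProd_neg (a : ℂ) {q : ℂ} (hq : ‖q‖ < 1) :
    qProd a q * qProd (-a) q = qProd (a ^ 2) (q ^ 2) := by
  rw [qProd, qProd, qProd, ← (multipliable_qProd a hq).tprod_mul (multipliable_qProd (-a) hq)]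
  refine tprod_congr fun k => ?_
  ring

theorem qProd_eq_one_sub_mul (a : ℂ) {q : ℂ} (hq : ‖q‖ < 1) :
    qProd a q = (1 - a) * qProd (a * q) q := by
  have h : Multipliable fun k : ℕ => 1 - a * q ^ (k + 1) :=
    (multipliable_qProd (a * q) hq).congr fun k => by rw [pow_succ']; ring
  have h1 := tprod_eq_zero_mul' (f := fun k : ℕ => 1 - a * q ^ k) h
  rw [pow_zero, mul_one] at h1
  rw [qProd, qProd, h1]
  congr 1
  refine tprod_congr fun k => ?_
  rw [pow_succ']
  ring

theorem eulerE_pow (n k : ℕ) (q : ℂ) : eulerE n (q ^ k) = eulerE (k * n) q := by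
  simp [eulerE, pow_mul]

theorem eulerE_ne_zero {q : ℂ} (hq : ‖q‖ < 1) {n : ℕ} (hn : n ≠ 0) : eulerE n q ≠ 0 :=
  qProd_ne_zero_of_norm_lt_one (norm_pow_lt_one hq hn) (norm_pow_lt_one hq hn)

theorem qProd_odd_mul_eulerE {q : ℂ} (hq : ‖q‖ < 1) :
    qProd q (q ^ 2) * eulerE 2 q = eulerE 1 q := by
  have h := qProd_eq_prod_fin q hq 2
  rw [Fin.prod_univ_two] at h
  simp only [Fin.val_zero, Fin.val_one, pow_zero, mul_one, pow_one, ← sq] at h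
  simp [eulerE, h]

theorem qProd_neg_odd_mul_eulerE {q : ℂ} (hq : ‖q‖ < 1) :
    qProd (-q) (q ^ 2) * eulerE 1 q * eulerE 4 q = eulerE 2 q ^ 2 := by
  have hq2 := norm_pow_lt_one hq two_ne_zero
  have h1 := qProd_odd_mul_eulerE hq
  have h2 := qProd_odd_mul_eulerE hq2
  have h3 := qProd_mul_qProd_neg q hq2
  rw [eulerE_pow, eulerE_pow] at h2
  norm_num at h2
  rw [← h1]
  linear_combination eulerE 2 q * eulerE 4 q * h3 + eulerE 2 q * h2

theorem qProd_neg_mul_eulerE {q : ℂ} (hq : ‖q‖ < 1) :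
    qProd (-q) q * eulerE 1 q = eulerE 2 q := by
  have h := qProd_mul_qProd_neg q hq
  simp only [eulerE, pow_one]
  linear_combination h

theorem eulerE_one_neg {q : ℂ} (hq : ‖q‖ < 1) :
    eulerE 1 (-q) * (eulerE 1 q * eulerE 4 q) = eulerE 2 q ^ 3 := by
  have h1 := qProd_odd_mul_eulerE (q := -q) (by simpa using hq)
  have h2 := qProd_neg_odd_mul_eulerE hq
  have h3 : eulerE 2 (-q) = eulerE 2 q := by simp [eulerE]
  rw [neg_sq, h3] at h1
  linear_combination eulerE 2 q * h2 - eulerE 1 q * eulerE 4 q * h1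

theorem theta_one_one_mul_eulerE {q : ℂ} (hq0 : q ≠ 0) (hq : ‖q‖ < 1) :
    theta 1 1 q * (eulerE 1 q ^ 2 * eulerE 4 q ^ 2) = eulerE 2 q ^ 5 := by
  have h := theta_eq_qProd hq0 hq (i := 1) (j := 1) (by norm_num)
  have h1 := qProd_neg_odd_mul_eulerE hq
  have h2 : qProd (q ^ 2) (q ^ 2) = eulerE 2 q := rfl
  norm_num [h2] at h
  rw [h]
  linear_combination eulerE 2 q *
    (qProd (-q) (q ^ 2) * eulerE 1 q * eulerE 4 q + eulerE 2 q ^ 2) * h1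

theorem theta_one_zero_mul_eulerE {q : ℂ} (hq0 : q ≠ 0) (hq : ‖q‖ < 1) :
    theta 1 0 q * eulerE 1 q = 2 * eulerE 2 q ^ 2 := by
  have h := theta_eq_qProd hq0 hq (i := 1) (j := 0) (by norm_num)
  have h1 := qProd_neg_mul_eulerE hq
  have h2 : qProd q q = eulerE 1 q := by simp [eulerE]
  -- For `j = 0` one product is `(-1; q)_∞ = 2 (-q; q)_∞`.
  have h3 := qProd_eq_one_sub_mul (-1) hq
  norm_num [h2] at h h3
  rw [h, h3]
  linear_combination 2 * (qProd (-q) q * eulerE 1 q + eulerE 2 q) * h1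

/-- `(-q; q²)_∞` splits into the products `(-q^r; q^10)_∞`, `r = 1, 3, 5, 7, 9`. The two theta
functions supply all but `r = 5`, which is the same product at `q^5`. -/
theorem theta_three_seven_mul_theta_one_nine {q : ℂ} (hq0 : q ≠ 0) (hq : ‖q‖ < 1) :
    theta 3 7 q * theta 1 9 q * (eulerE 1 q * eulerE 4 q) =
      eulerE 2 q ^ 2 * eulerE 5 q * eulerE 20 q := by
  have h := theta_eq_qProd hq0 hq (i := 3) (j := 7) (by norm_num)
  have h' := theta_eq_qProd hq0 hq (i := 1) (j := 9) (by norm_num)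
  have hE : qProd (q ^ 10) (q ^ 10) = eulerE 10 q := rfl
  norm_num [hE] at h h'
  have h1 := qProd_neg_odd_mul_eulerE hq
  have h5 := qProd_neg_odd_mul_eulerE (norm_pow_lt_one hq (n := 5) (by norm_num))
  simp only [eulerE_pow, ← pow_mul] at h5
  norm_num at h5
  have hs := qProd_eq_prod_fin (-q) (norm_pow_lt_one hq two_ne_zero) 5
  rw [Fin.prod_univ_five] at hs
  have e : ∀ k : ℕ, -q * (q ^ 2) ^ k = -q ^ (2 * k + 1) := fun k => by ring
  simp only [e] at hs
  simp only [← pow_mul] at hs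
  norm_num at hs
  rw [hs] at h1
  rw [h, h']
  linear_combination eulerE 5 q * eulerE 20 q * h1 - qProd (-q) (q ^ 10) * qProd (-q ^ 3) (q ^ 10) *
    qProd (-q ^ 7) (q ^ 10) * qProd (-q ^ 9) (q ^ 10) * eulerE 1 q * eulerE 4 q * h5

theorem theta_two_three_mul_theta_one_four {q : ℂ} (hq0 : q ≠ 0) (hq : ‖q‖ < 1) :
    theta 2 3 q * theta 1 4 q * (eulerE 1 q * eulerE 10 q) = eulerE 2 q * eulerE 5 q ^ 3 := by
  have h := theta_eq_qProd hq0 hq (i := 2) (j := 3) (by norm_num)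
  have h' := theta_eq_qProd hq0 hq (i := 1) (j := 4) (by norm_num)
  have hE : qProd (q ^ 5) (q ^ 5) = eulerE 5 q := rfl
  norm_num [hE] at h h'
  have h1 := qProd_neg_mul_eulerE hq
  have h5 := qProd_neg_mul_eulerE (norm_pow_lt_one hq (n := 5) (by norm_num))
  simp only [eulerE_pow] at h5
  norm_num at h5
  have hs := qProd_eq_prod_fin (-q) hq 5
  rw [Fin.prod_univ_five] at hs
  have e : ∀ k : ℕ, -q * q ^ k = -q ^ (k + 1) := fun k => by ring
  simp only [e] at hs
  norm_num at hs
  rw [hs] at h1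
  rw [h, h', ← h5]
  linear_combination eulerE 5 q ^ 3 * h1

theorem theta_one_zero_sq_eq_mul {q : ℂ} (hq0 : q ≠ 0) (hq : ‖q‖ < 1) :
    theta 1 0 q ^ 2 = 2 * theta 1 1 q * theta 1 0 (q ^ 2) := by
  have h1 := theta_one_one_mul_eulerE hq0 hq
  have h2 := theta_one_zero_mul_eulerE hq0 hq
  have h3 := theta_one_zero_mul_eulerE (pow_ne_zero 2 hq0) (norm_pow_lt_one hq two_ne_zero)
  simp only [eulerE_pow] at h3
  norm_num at h3
  have e1 := eulerE_ne_zero hq one_ne_zero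
  have e2 := eulerE_ne_zero hq two_ne_zero
  have e4 := eulerE_ne_zero hq four_ne_zero
  rw [← eq_div_iff (by positivity)] at h1 h2 h3
  rw [h1, h2, h3]
  field_simp

/-! ### Relations between the components of the dissections -/

/-- A polynomial of degree at most 4 with five distinct roots vanishes. This is how components of a
5-dissection are compared. -/
theorem coeff_eq_zero_of_fifth_roots {y : ℂ} (hy : y ≠ 0) {c₀ c₁ c₂ c₃ c₄ : ℂ}
    (h : ∀ s : ℂ, s ^ 5 = y → c₀ + c₁ * s + c₂ * s ^ 2 + c₃ * s ^ 3 + c₄ * s ^ 4 = 0) :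
    c₀ = 0 ∧ c₁ = 0 ∧ c₂ = 0 ∧ c₃ = 0 ∧ c₄ = 0 := by
  obtain ⟨t, ht⟩ := IsAlgClosed.exists_pow_nat_eq y (n := 5) (by norm_num)
  have ht0 : t ≠ 0 := by
    rintro rfl
    exact hy (by simpa using ht.symm)
  have hζ := Complex.isPrimitiveRoot_exp 5 (by norm_num)
  set ζ := Complex.exp (2 * Real.pi * Complex.I / (5 : ℕ))
  let p : Polynomial ℂ := .C c₀ + .C c₁ * .X + .C c₂ * .X ^ 2 + .C c₃ * .X ^ 3 + .C c₄ * .X ^ 4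
  have hp : p = 0 := by
    refine Polynomial.eq_zero_of_natDegree_lt_card_of_eval_eq_zero p
      (f := fun k : Fin 5 => ζ ^ (k : ℕ) * t) ?_ ?_ ?_
    · intro i j hij
      exact Fin.ext (hζ.pow_inj i.2 j.2 (mul_right_cancel₀ ht0 hij))
    · intro k
      have := h (ζ ^ (k : ℕ) * t) (by
        rw [mul_pow, ht, ← pow_mul, mul_comm _ 5, pow_mul, hζ.pow_eq_one, one_pow, one_mul])
      simpa [p] using this
    · have : p.natDegree ≤ 4 := by
        simp only [p]
        compute_degree
      simp only [Fintype.card_fin]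
      omega
  have hc : ∀ n, p.coeff n = 0 := fun n => by rw [hp, Polynomial.coeff_zero]
  have h0 := hc 0
  have h1 := hc 1
  have h2 := hc 2
  have h3 := hc 3
  have h4 := hc 4
  simp [p, Polynomial.coeff_X, Polynomial.coeff_C] at h0 h1 h2 h3 h4
  exact ⟨h0, h1, h2, h3, h4⟩

/-- The three homogeneous relations between the components of the 5-dissections of
`φ(q) = f(q, q)` and `ψ(q) = f(q, q³)`. -/
theorem theta_relations {y : ℂ} (hy0 : y ≠ 0) (hy : ‖y‖ < 1) {A B C P Q R : ℂ}
    (hA : A = theta 5 5 y) (hB : B = theta 3 7 y) (hC : C = theta 1 9 y)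
    (hP : P = theta 2 3 y) (hQ : Q = theta 1 4 y) (hR : 2 * R = theta 5 0 y) :
    A * C * P ^ 2 = A ^ 2 * Q * R + 2 * y ^ 2 * C ^ 2 * R ^ 2 ∧
      A * B * Q ^ 2 = A ^ 2 * P * R + 2 * y * B ^ 2 * R ^ 2 ∧
      B * C * P * Q = B ^ 2 * Q * R + y * C ^ 2 * P * R := by
  have hRR : theta 5 0 y ^ 2 = 2 * theta 5 5 y * theta 5 0 (y ^ 2) := by
    have := theta_one_zero_sq_eq_mul (pow_ne_zero 5 hy0) (norm_pow_lt_one hy (n := 5) (by norm_num))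
    rw [← pow_mul, mul_comm 5 2, pow_mul] at this
    simpa only [theta_pow] using this
  -- The coefficients of `ψ(s)² - φ(s)ψ(s²)` reduced by `s⁵ = y`; the theta functions at `y²` are
  -- the components of `ψ(s²)`.
  have key := coeff_eq_zero_of_fifth_roots hy0 (c₀ := P ^ 2 - A * theta 2 3 (y ^ 2) -
      y ^ 2 * C * theta 5 0 (y ^ 2))
    (c₁ := 2 * P * Q + y * R ^ 2 - y * A * theta 5 0 (y ^ 2) / 2 - 2 * B * theta 2 3 (y ^ 2) -
      2 * y * C * theta 1 4 (y ^ 2))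
    (c₂ := Q ^ 2 - A * theta 1 4 (y ^ 2) - y * B * theta 5 0 (y ^ 2))
    (c₃ := 2 * P * R - 2 * B * theta 1 4 (y ^ 2))
    (c₄ := 2 * Q * R - 2 * C * theta 2 3 (y ^ 2)) (fun s hs => by
      have hs0 : s ≠ 0 := by
        rintro rfl
        exact hy0 (by simpa using hs.symm)
      have hs1 : ‖s‖ < 1 := by
        rw [← hs, norm_pow] at hy
        exact (pow_lt_one_iff_of_nonneg (norm_nonneg s) (by norm_num)).1 hy
      have h := theta_one_zero_sq_eq_mul hs0 hs1
      rw [theta_one_zero_dissection hs0 hs1, theta_one_one_dissection hs0 hs1,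
        theta_one_zero_dissection (pow_ne_zero 2 hs0) (norm_pow_lt_one hs1 two_ne_zero),
        ← pow_mul, mul_comm 2 5, pow_mul, hs, ← hA, ← hB, ← hC, ← hP, ← hQ, ← hR] at h
      linear_combination h / 4 + (s * (A * theta 5 0 (y ^ 2) / 2 + 2 * C * theta 1 4 (y ^ 2) -
        R ^ 2) + B * theta 5 0 (y ^ 2) * s ^ 2 + C * theta 5 0 (y ^ 2) * (s ^ 5 + y)) * hs)
  obtain ⟨k0, k1, k2, k3, k4⟩ := key
  rw [← hR, ← hA] at hRR
  refine ⟨?_, ?_, ?_⟩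
  -- `k4`, `k3` and `hRR` eliminate the three theta functions at `y²`.
  · linear_combination A * C * k0 - y ^ 2 * C ^ 2 * hRR / 2 - A ^ 2 * k4 / 2
  · linear_combination A * B * k2 - y * B ^ 2 * hRR / 2 - A ^ 2 * k3 / 2
  · linear_combination B * C * k1 / 2 - y * B * C * hRR / 8 - B ^ 2 * k4 / 2 - y * C ^ 2 * k3 / 2

/-! ### The generating function of regular partitions -/

/-- The series `f` converges absolutely at `z`, with sum `w`. -/
def AbsHasEval (f : PowerSeries ℝ) (z w : ℂ) : Prop :=
  (Summable fun n : ℕ => ‖((f.coeff n : ℝ) : ℂ) * z ^ n‖) ∧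
    ∑' n : ℕ, ((f.coeff n : ℝ) : ℂ) * z ^ n = w

theorem AbsHasEval.mul {f g : PowerSeries ℝ} {z v w : ℂ} (hf : AbsHasEval f z v)
    (hg : AbsHasEval g z w) : AbsHasEval (f * g) z (v * w) := by
  have e : ∀ n : ℕ, (((f * g).coeff n : ℝ) : ℂ) * z ^ n =
      ∑ p ∈ Finset.HasAntidiagonal.antidiagonal n,
        ((f.coeff p.1 : ℝ) : ℂ) * z ^ p.1 * (((g.coeff p.2 : ℝ) : ℂ) * z ^ p.2) := by
    intro n
    rw [PowerSeries.coeff_mul]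
    push_cast
    rw [Finset.sum_mul]
    refine Finset.sum_congr rfl fun p hp => ?_
    rw [← Finset.HasAntidiagonal.mem_antidiagonal.1 hp, pow_add]
    ring
  have h1 := summable_norm_sum_mul_antidiagonal_of_summable_norm
    (f := fun n : ℕ => ((f.coeff n : ℝ) : ℂ) * z ^ n)
    (g := fun n : ℕ => ((g.coeff n : ℝ) : ℂ) * z ^ n) hf.1 hg.1
  have h2 := tsum_mul_tsum_eq_tsum_sum_antidiagonal_of_summable_norm
    (f := fun n : ℕ => ((f.coeff n : ℝ) : ℂ) * z ^ n)
    (g := fun n : ℕ => ((g.coeff n : ℝ) : ℂ) * z ^ n) hf.1 hg.1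
  rw [hf.2, hg.2] at h2
  exact ⟨h1.congr fun n => by rw [e], (tsum_congr e).trans h2.symm⟩

theorem AbsHasEval.one (z : ℂ) : AbsHasEval 1 z 1 := by
  have e : ∀ n : ℕ, n ≠ 0 → (((1 : PowerSeries ℝ).coeff n : ℝ) : ℂ) * z ^ n = 0 := by
    intro n hn
    simp [PowerSeries.coeff_one, hn]
  refine ⟨summable_of_ne_finset_zero (s := {0}) fun n hn => ?_, ?_⟩
  · rw [e n (by simpa using hn), norm_zero]
  · rw [tsum_eq_single 0 e]
    simp

theorem AbsHasEval.prod {ι : Type*} {f : ι → PowerSeries ℝ} {z : ℂ} {w : ι → ℂ} (s : Finset ι)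
    (h : ∀ i, AbsHasEval (f i) z (w i)) : AbsHasEval (∏ i ∈ s, f i) z (∏ i ∈ s, w i) := by
  classical
  induction s using Finset.induction_on with
  | empty => simpa using AbsHasEval.one z
  | insert i s hi ih =>
    rw [Finset.prod_insert hi, Finset.prod_insert hi]
    exact (h i).mul ih

open PowerSeries.WithPiTopology in
theorem tsum_X_pow_mul {d : ℕ} (hd : d ≠ 0) :
    ∑' j : ℕ, (PowerSeries.X : PowerSeries ℝ) ^ (d * j) =
      PowerSeries.mk fun n => if d ∣ n then 1 else 0 := by
  have h0 : PowerSeries.constantCoeff ((PowerSeries.X : PowerSeries ℝ) ^ d) = 0 := by simp [hd]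
  have h1 := PowerSeries.WithPiTopology.tsum_pow_mul_one_sub_of_constantCoeff_eq_zero h0
  have h2 : (PowerSeries.mk fun n => if d ∣ n then (1 : ℝ) else 0) * (1 - PowerSeries.X ^ d) = 1 := by
    ext n
    rw [mul_sub, mul_one, map_sub, PowerSeries.coeff_mul_X_pow', PowerSeries.coeff_one]
    simp only [PowerSeries.coeff_mk]
    rcases Nat.eq_zero_or_pos n with rfl | hn
    · simp [hd]
    · rw [if_neg hn.ne']
      split_ifs with h3 h4 h5 h5 h6
      · simp
      · exact absurd (Nat.dvd_sub h3 (dvd_refl d)) h5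
      · exact absurd (Nat.le_of_dvd hn h3) h4
      · exfalso
        apply h3
        have := dvd_add h6 (dvd_refl d)
        rwa [Nat.sub_add_cancel (by assumption)] at this
      · simp
      · simp
  simp_rw [pow_mul]
  have h3 : (1 - PowerSeries.X ^ d : PowerSeries ℝ) ≠ 0 := right_ne_zero_of_mul_eq_one h2
  exact mul_right_cancel₀ h3 (h1.trans h2.symm)

theorem absHasEval_geometric {d : ℕ} (hd : d ≠ 0) {z : ℂ} (hz : ‖z‖ < 1) :
    AbsHasEval (PowerSeries.mk fun n => if d ∣ n then 1 else 0) z (1 - z ^ d)⁻¹ := by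
  have hs : HasSum (fun n : ℕ =>
      ((((PowerSeries.mk fun n => if d ∣ n then (1 : ℝ) else 0).coeff n : ℝ) : ℂ) * z ^ n))
      (1 - z ^ d)⁻¹ := by
    have h := hasSum_geometric_of_norm_lt_one (norm_pow_lt_one hz hd)
    have hinj : Function.Injective fun j : ℕ => d * j := fun a b h =>
      Nat.eq_of_mul_eq_mul_left (Nat.pos_of_ne_zero hd) h
    rw [← hinj.hasSum_iff]
    · simpa [Function.comp_def, pow_mul] using h
    · intro n hn
      have : ¬ d ∣ n := fun ⟨k, hk⟩ => hn ⟨k, hk.symm⟩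
      simp [this]
  exact ⟨hs.summable.norm, hs.tsum_eq⟩

/-- The local factor at the part `i + 1` of the generating function of `l`-regular partitions. -/
noncomputable def regularFactor (l i : ℕ) : PowerSeries ℝ :=
  if ¬ l ∣ i + 1 then PowerSeries.mk fun n => if i + 1 ∣ n then 1 else 0 else 1

theorem regularFactor_coeff_nonneg (l i n : ℕ) : 0 ≤ (regularFactor l i).coeff n := by
  unfold regularFactor
  split_ifs
  · rw [PowerSeries.coeff_one]
    split_ifs <;> norm_num
  · rw [PowerSeries.coeff_mk]
    split_ifs <;> norm_num

theorem regularFactor_coeff_zero (l i : ℕ) : (regularFactor l i).coeff 0 = 1 := by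
  unfold regularFactor
  split_ifs <;> simp

theorem absHasEval_regularFactor (l i : ℕ) {z : ℂ} (hz : ‖z‖ < 1) :
    AbsHasEval (regularFactor l i) z (if ¬ l ∣ i + 1 then (1 - z ^ (i + 1))⁻¹ else 1) := by
  unfold regularFactor
  split_ifs
  · exact AbsHasEval.one z
  · exact absHasEval_geometric i.succ_ne_zero hz

theorem prod_regularFactor_coeff_nonneg (l N n : ℕ) :
    0 ≤ (∏ i ∈ Finset.range N, regularFactor l i).coeff n := by
  induction N generalizing n with
  | zero =>
    rw [Finset.prod_range_zero, PowerSeries.coeff_one]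
    split_ifs <;> norm_num
  | succ N ih =>
    rw [Finset.prod_range_succ, PowerSeries.coeff_mul]
    exact Finset.sum_nonneg fun p _ => mul_nonneg (ih _) (regularFactor_coeff_nonneg _ _ _)

theorem monotone_prod_regularFactor_coeff (l n : ℕ) :
    Monotone fun N => (∏ i ∈ Finset.range N, regularFactor l i).coeff n := by
  refine monotone_nat_of_le_succ fun N => ?_
  rw [Finset.prod_range_succ, PowerSeries.coeff_mul]
  calc _ = (∏ i ∈ Finset.range N, regularFactor l i).coeff n * (regularFactor l N).coeff 0 := by
        rw [regularFactor_coeff_zero, mul_one]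
    _ ≤ _ := Finset.single_le_sum
        (f := fun p : ℕ × ℕ => (∏ i ∈ Finset.range N, regularFactor l i).coeff p.1 *
          (regularFactor l N).coeff p.2)
        (fun p _ => mul_nonneg (prod_regularFactor_coeff_nonneg _ _ _)
          (regularFactor_coeff_nonneg _ _ _))
        (Finset.HasAntidiagonal.mem_antidiagonal.2 (by simp) :
          ((n, 0) : ℕ × ℕ) ∈ Finset.HasAntidiagonal.antidiagonal n)

open PowerSeries.WithPiTopology in
theorem tendsto_prod_regularFactor_coeff (l n : ℕ) :
    Tendsto (fun N => (∏ i ∈ Finset.range N, regularFactor l i).coeff n) atTop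
      (𝓝 (numRegularPartitions l n : ℝ)) := by
  have h := Nat.Partition.hasProd_powerSeriesMk_card_restricted ℝ (fun i => ¬ l ∣ i)
  have e : (fun i : ℕ => if ¬ l ∣ i + 1 then
      ∑' j : ℕ, (PowerSeries.X : PowerSeries ℝ) ^ ((i + 1) * j) else 1) = regularFactor l := by
    funext i
    rw [tsum_X_pow_mul i.succ_ne_zero]
    rfl
  rw [e] at h
  have h1 := (PowerSeries.WithPiTopology.tendsto_iff_coeff_tendsto ℝ _ _ _).1 h.tendsto_prod_nat n
  simpa [numRegularPartitions] using h1

theorem tendsto_prod_regular {l : ℕ} (hl : l ≠ 0) {z : ℂ} (hz : ‖z‖ < 1) :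
    Tendsto (fun N => ∏ i ∈ Finset.range N, (if ¬ l ∣ i + 1 then (1 - z ^ (i + 1))⁻¹ else 1)) atTop
      (𝓝 (eulerE l z / eulerE 1 z)) := by
  have h1 := tendsto_prod_range_qProd z hz
  have h2 : HasProd (fun i : ℕ => if l ∣ i + 1 then 1 - z ^ (i + 1) else 1) (eulerE l z) := by
    -- Index `i` stands for the part `i + 1`, so the multiples of `l` sit at `i = l * k + (l - 1)`.
    have hinj : Function.Injective fun k : ℕ => l * k + (l - 1) := fun a b h =>
      Nat.eq_of_mul_eq_mul_left (Nat.pos_of_ne_zero hl) (Nat.add_right_cancel h)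
    have e : ∀ k : ℕ, l * k + (l - 1) + 1 = l * (k + 1) := fun k => by
      rw [mul_add, mul_one]
      omega
    rw [← hinj.hasProd_iff]
    · have : HasProd _ (eulerE l z) :=
        (multipliable_qProd (z ^ l) (norm_pow_lt_one hz hl)).hasProd
      convert this using 1
      funext k
      simp only [Function.comp, e, dvd_mul_right, if_true]
      rw [pow_mul, pow_succ']
    · intro n hn
      refine if_neg fun ⟨k, hk⟩ => hn ?_
      rcases k with _ | k
      · simp at hk
      · exact ⟨k, by have := e k; simp only; omega⟩
  have h3 := h2.tendsto_prod_nat.div h1 (qProd_ne_zero_of_norm_lt_one hz hz)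
  have e1 : eulerE 1 z = qProd z z := by simp [eulerE]
  rw [e1]
  refine h3.congr fun N => ?_
  simp only [Pi.div_apply]
  rw [← Finset.prod_div_distrib]
  refine Finset.prod_congr rfl fun i _ => ?_
  rw [← pow_succ']
  have := one_sub_ne_zero_of_norm_lt_one (norm_pow_lt_one hz i.succ_ne_zero)
  by_cases h : l ∣ i + 1
  · simp [h, div_self this]
  · simp [h]

/-- At real `r ≥ 0` all terms are nonnegative: every partial sum is a limit of truncations of the
finite products, whose values at `r` converge and so are bounded. -/
theorem summable_numRegularPartitions {l : ℕ} (hl : l ≠ 0) {r : ℝ} (hr0 : 0 ≤ r) (hr : r < 1) :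
    Summable fun n : ℕ => (numRegularPartitions l n : ℝ) * r ^ n := by
  have hz : ‖(r : ℂ)‖ < 1 := by simpa [abs_of_nonneg hr0] using hr
  obtain ⟨K, hK⟩ := (tendsto_prod_regular hl hz).norm.bddAbove_range
  refine summable_of_sum_range_le (c := K) (fun n => by positivity) fun M => ?_
  have ht : Tendsto (fun N => ∑ n ∈ Finset.range M,
      (∏ i ∈ Finset.range N, regularFactor l i).coeff n * r ^ n) atTop
      (𝓝 (∑ n ∈ Finset.range M, (numRegularPartitions l n : ℝ) * r ^ n)) :=
    tendsto_finsetSum _ fun n _ => (tendsto_prod_regularFactor_coeff l n).mul_const _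
  refine le_of_tendsto' ht fun N => ?_
  have h := AbsHasEval.prod (Finset.range N) fun i => absHasEval_regularFactor l i hz
  have hpos : ∀ n, 0 ≤ (∏ i ∈ Finset.range N, regularFactor l i).coeff n * r ^ n := fun n =>
    mul_nonneg (prod_regularFactor_coeff_nonneg l N n) (pow_nonneg hr0 n)
  have e : ∀ n, ((((∏ i ∈ Finset.range N, regularFactor l i).coeff n : ℝ) : ℂ) * (r : ℂ) ^ n) =
      (((∏ i ∈ Finset.range N, regularFactor l i).coeff n * r ^ n : ℝ) : ℂ) := fun n => by
    push_cast
    rfl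
  have hs := h.1
  have hv := h.2
  simp_rw [e] at hs hv
  rw [← Complex.ofReal_tsum] at hv
  have hs' : Summable fun n => (∏ i ∈ Finset.range N, regularFactor l i).coeff n * r ^ n := by
    refine hs.congr fun n => ?_
    rw [Complex.norm_real, Real.norm_of_nonneg (hpos n)]
  calc _ ≤ ∑' n, (∏ i ∈ Finset.range N, regularFactor l i).coeff n * r ^ n :=
        hs'.sum_le_tsum _ fun n _ => hpos n
    _ = ‖((∑' n, (∏ i ∈ Finset.range N, regularFactor l i).coeff n * r ^ n : ℝ) : ℂ)‖ := by
        rw [Complex.norm_real, Real.norm_of_nonneg (tsum_nonneg hpos)]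
    _ ≤ K := by
        rw [hv]
        exact hK ⟨N, rfl⟩

/-- The generating function of `l`-regular partitions, as an analytic function. -/
theorem hasSum_numRegularPartitions {l : ℕ} (hl : l ≠ 0) {z : ℂ} (hz : ‖z‖ < 1) :
    HasSum (fun n : ℕ => (numRegularPartitions l n : ℂ) * z ^ n) (eulerE l z / eulerE 1 z) := by
  have hsum := summable_numRegularPartitions hl (norm_nonneg z) hz
  have hs : Summable fun n : ℕ => (numRegularPartitions l n : ℂ) * z ^ n := by
    refine Summable.of_norm (hsum.congr fun n => ?_)
    simp
  have ht : Tendsto (fun N => ∑' n : ℕ,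
      (((∏ i ∈ Finset.range N, regularFactor l i).coeff n : ℝ) : ℂ) * z ^ n) atTop
      (𝓝 (∑' n : ℕ, (numRegularPartitions l n : ℂ) * z ^ n)) := by
    -- The coefficients of the finite products increase to those of the limit, which therefore
    -- dominate.
    refine tendsto_tsum_of_dominated_convergence hsum (fun n => ?_)
      (Eventually.of_forall fun N n => ?_)
    · have := (Complex.continuous_ofReal.tendsto _).comp (tendsto_prod_regularFactor_coeff l n)
      simpa using this.mul_const (z ^ n)
    · rw [norm_mul, norm_pow, Complex.norm_real,
        Real.norm_of_nonneg (prod_regularFactor_coeff_nonneg l N n)]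
      gcongr
      exact (monotone_prod_regularFactor_coeff l n).ge_of_tendsto
        (tendsto_prod_regularFactor_coeff l n) N
  have e : ∀ N, ∑' n : ℕ, (((∏ i ∈ Finset.range N, regularFactor l i).coeff n : ℝ) : ℂ) * z ^ n =
      ∏ i ∈ Finset.range N, (if ¬ l ∣ i + 1 then (1 - z ^ (i + 1))⁻¹ else 1) := fun N =>
    (AbsHasEval.prod (Finset.range N) fun i => absHasEval_regularFactor l i hz).2
  simp_rw [e] at ht
  rw [← tendsto_nhds_unique ht (tendsto_prod_regular hl hz)]
  exact hs.hasSum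

/-! ### The dissection of the generating function -/

/-- The product of `A + 2sB + 2s⁴C` over the fifth roots `s` of `y`. -/
def dissectionNorm (y A B C : ℂ) : ℂ :=
  A ^ 5 + 32 * y * B ^ 5 + 32 * y ^ 4 * C ^ 5 - 20 * y * A ^ 3 * B * C +
    80 * y ^ 2 * A * B ^ 2 * C ^ 2

/-- The factors at conjugate roots of unity are paired, `ζ` with `ζ⁴` and `ζ²` with `ζ³`; the
periods `a`, `b` satisfy `a + b = ab = -1`, so the full product is free of `ζ`. -/
theorem dissectionNorm_ne_zero {y A B C : ℂ}
    (h : ∀ s : ℂ, s ^ 5 = y → A + 2 * s * B + 2 * s ^ 4 * C ≠ 0) :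
    dissectionNorm y A B C ≠ 0 := by
  obtain ⟨t, ht⟩ := IsAlgClosed.exists_pow_nat_eq y (n := 5) (by norm_num)
  have hζ := Complex.isPrimitiveRoot_exp 5 (by norm_num)
  set ζ := Complex.exp (2 * Real.pi * Complex.I / (5 : ℕ))
  have h5 : ζ ^ 5 = 1 := hζ.pow_eq_one
  have hsum : 1 + ζ + ζ ^ 2 + ζ ^ 3 + ζ ^ 4 = 0 := by
    have := hζ.geom_sum_eq_zero (by norm_num)
    simpa [Finset.sum_range_succ] using this
  have hk : ∀ k : ℕ, A + 2 * (ζ ^ k * t) * B + 2 * (ζ ^ k * t) ^ 4 * C ≠ 0 := fun k =>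
    h _ (by rw [mul_pow, ht, ← pow_mul, mul_comm k 5, pow_mul, h5, one_pow, one_mul])
  obtain ⟨x, hx⟩ : ∃ x, x = 2 * t * B := ⟨_, rfl⟩
  obtain ⟨w, hw⟩ : ∃ w, w = 2 * t ^ 4 * C := ⟨_, rfl⟩
  obtain ⟨a, ha⟩ : ∃ a, a = ζ + ζ ^ 4 := ⟨_, rfl⟩
  obtain ⟨b, hb⟩ : ∃ b, b = ζ ^ 2 + ζ ^ 3 := ⟨_, rfl⟩
  have hab : a + b = -1 := by linear_combination ha + hb + hsum
  have hab' : a * b = -1 := by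
    rw [ha, hb]
    linear_combination hsum + (ζ + ζ ^ 2) * h5
  have h0 : A + x + w ≠ 0 := by
    have := hk 0
    rw [hx, hw]
    simpa using this
  have h14 : A ^ 2 + x ^ 2 + w ^ 2 + a * (A * x + A * w) + b * (x * w) ≠ 0 := by
    have := mul_ne_zero (hk 1) (hk 4)
    contrapose! this
    rw [← this, hx, hw, ha, hb]
    linear_combination (4 * t ^ 2 * B ^ 2 + 4 * t ^ 8 * C ^ 2 * (1 + ζ ^ 5 + ζ ^ 10 + ζ ^ 15) +
      2 * A * C * t ^ 4 * ζ * (1 + ζ ^ 5 + ζ ^ 10) +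
      4 * t ^ 5 * B * C * (ζ ^ 3 + ζ ^ 2 * (1 + ζ ^ 5 + ζ ^ 10))) * h5
  have h23 : A ^ 2 + x ^ 2 + w ^ 2 + b * (A * x + A * w) + a * (x * w) ≠ 0 := by
    have := mul_ne_zero (hk 2) (hk 3)
    contrapose! this
    rw [← this, hx, hw, ha, hb]
    linear_combination (4 * t ^ 2 * B ^ 2 + 4 * t ^ 8 * C ^ 2 * (1 + ζ ^ 5 + ζ ^ 10 + ζ ^ 15) +
      2 * A * C * t ^ 4 * (ζ ^ 3 + ζ ^ 2 * (1 + ζ ^ 5)) +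
      4 * t ^ 5 * B * C * (ζ * (1 + ζ ^ 5) + ζ ^ 4 * (1 + ζ ^ 5))) * h5
  have key : dissectionNorm y A B C = (A + x + w) *
      ((A ^ 2 + x ^ 2 + w ^ 2 + a * (A * x + A * w) + b * (x * w)) *
        (A ^ 2 + x ^ 2 + w ^ 2 + b * (A * x + A * w) + a * (x * w))) := by
    have e : (A ^ 2 + x ^ 2 + w ^ 2 + a * (A * x + A * w) + b * (x * w)) *
        (A ^ 2 + x ^ 2 + w ^ 2 + b * (A * x + A * w) + a * (x * w)) =
        (A ^ 2 + x ^ 2 + w ^ 2) ^ 2 - (A ^ 2 + x ^ 2 + w ^ 2) * (A * x + A * w + x * w) -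
          (A * x + A * w) ^ 2 - (x * w) ^ 2 + 3 * (A * x + A * w) * (x * w) := by
      linear_combination ((A ^ 2 + x ^ 2 + w ^ 2) * (A * x + A * w + x * w) +
        (A * x + A * w) * (x * w) * (a + b - 1)) * hab +
        ((A * x + A * w) ^ 2 + (x * w) ^ 2 - 2 * (A * x + A * w) * (x * w)) * hab'
    rw [e, hx, hw, ← ht, dissectionNorm]
    ring
  rw [key]
  exact mul_ne_zero h0 (mul_ne_zero h14 h23)

/-- After multiplication by `BC` the difference of the two sides is an explicit combination of the
three relations; hence `B` and `C` must be nonzero. -/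
theorem dissection_identity {y A B C P Q R : ℂ} (hB : B ≠ 0) (hC : C ≠ 0)
    (h₁ : A * C * P ^ 2 = A ^ 2 * Q * R + 2 * y ^ 2 * C ^ 2 * R ^ 2)
    (h₂ : A * B * Q ^ 2 = A ^ 2 * P * R + 2 * y * B ^ 2 * R ^ 2)
    (h₃ : B * C * P * Q = B ^ 2 * Q * R + y * C ^ 2 * P * R) :
    (P * (-8 * A * B ^ 3 + 4 * y * A ^ 2 * C ^ 2 - 16 * y ^ 2 * B * C ^ 3) +
        Q * (4 * A ^ 2 * B ^ 2 - 16 * y * B ^ 3 * C - 8 * y ^ 2 * A * C ^ 3) +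
        R * (A ^ 4 - 12 * y * A ^ 2 * B * C + 16 * y ^ 2 * B ^ 2 * C ^ 2)) *
          (A * (A ^ 2 + 4 * y * (B * C)) * (P * Q + y * R ^ 2)) =
      -(R * (3 * A ^ 2 * (P * Q) - y * A ^ 2 * R ^ 2 + 4 * y ^ 2 * R ^ 2 * (B * C)) *
        dissectionNorm y A B C) := by
  apply mul_left_cancel₀ (mul_ne_zero hB hC)
  rw [dissectionNorm]
  linear_combination
    (-8 * A ^ 3 * B ^ 4 * Q - 4 * A ^ 5 * B ^ 2 * R + 64 * y * A * B ^ 5 * C * Q + 48 * y * A ^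
      3 * B ^ 3 * C * R - 4 * y * A ^ 4 * B * C ^ 2 * Q - 96 * y ^ 2 * A * B ^ 4 * C ^ 2 * R +
      48 * y ^ 2 * A ^ 2 * B ^ 2 * C ^ 3 * Q + 16 * y ^ 3 * A ^ 2 * B * C ^ 4 * R - 64 * y ^ 4 *
      B ^ 2 * C ^ 5 * R) * h₁ +
    (-4 * A ^ 4 * B ^ 2 * C * P + 48 * y * A ^ 2 * B ^ 3 * C ^ 2 * P + 16 * y * A ^ 2 * B ^ 4 *
      C * R - 4 * y * A ^ 5 * C ^ 2 * R - 64 * y ^ 2 * B ^ 5 * C ^ 2 * R - 8 * y ^ 2 * A ^ 3 * C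
      ^ 4 * P + 48 * y ^ 2 * A ^ 3 * B * C ^ 3 * R + 64 * y ^ 3 * A * B * C ^ 5 * P - 96 * y ^ 3
      * A * B ^ 2 * C ^ 4 * R) * h₂ +
    (8 * A ^ 5 * B ^ 2 * Q + 4 * A ^ 7 * R - 96 * y * A ^ 2 * B ^ 4 * C * P - 48 * y * A ^ 3 *
      B ^ 3 * C * Q + 8 * y * A ^ 5 * C ^ 2 * P - 52 * y * A ^ 5 * B * C * R - 64 * y ^ 2 * A *
      B ^ 4 * C ^ 2 * Q - 48 * y ^ 2 * A ^ 3 * B * C ^ 3 * P + 112 * y ^ 2 * A ^ 3 * B ^ 2 * C ^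
      2 * R - 64 * y ^ 3 * A * B ^ 2 * C ^ 4 * P - 64 * y ^ 3 * A * B ^ 3 * C ^ 3 * R - 96 * y ^
      3 * A ^ 2 * B * C ^ 4 * Q) * h₃

/-- Cramer's rule for multiplication by `A + 2sB + 2s⁴C` modulo `s⁵ = y`: the determinant is
`dissectionNorm`, and the multipliers of the `eᵢ` are the cofactors for `g₃`. -/
theorem dissection_coefficient {y A B C P Q R g₀ g₁ g₂ g₃ g₄ : ℂ}
    (e₀ : A * g₀ + 2 * y * B * g₄ + 2 * y * C * g₁ = P)
    (e₁ : A * g₁ + 2 * B * g₀ + 2 * y * C * g₂ = Q)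
    (e₂ : A * g₂ + 2 * B * g₁ + 2 * y * C * g₃ = 0)
    (e₃ : A * g₃ + 2 * B * g₂ + 2 * y * C * g₄ = R)
    (e₄ : A * g₄ + 2 * B * g₃ + 2 * C * g₀ = 0) :
    dissectionNorm y A B C * g₃ =
      P * (-8 * A * B ^ 3 + 4 * y * A ^ 2 * C ^ 2 - 16 * y ^ 2 * B * C ^ 3) +
        Q * (4 * A ^ 2 * B ^ 2 - 16 * y * B ^ 3 * C - 8 * y ^ 2 * A * C ^ 3) +
        R * (A ^ 4 - 12 * y * A ^ 2 * B * C + 16 * y ^ 2 * B ^ 2 * C ^ 2) := by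
  rw [dissectionNorm]
  linear_combination (-8 * A * B ^ 3 + 4 * y * A ^ 2 * C ^ 2 - 16 * y ^ 2 * B * C ^ 3) * e₀ +
    (4 * A ^ 2 * B ^ 2 - 16 * y * B ^ 3 * C - 8 * y ^ 2 * A * C ^ 3) * e₁ +
    (-2 * A ^ 3 * B + 16 * y * A * B ^ 2 * C + 16 * y ^ 3 * C ^ 4) * e₂ +
    (A ^ 4 - 12 * y * A ^ 2 * B * C + 16 * y ^ 2 * B ^ 2 * C ^ 2) * e₃ +
    y * (-2 * A ^ 3 * C + 16 * y * A * B * C ^ 2 + 16 * B ^ 4) * e₄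

theorem tsum_nat_eq_sum_mod_five {f : ℕ → ℂ} (hf : Summable f) :
    ∑' n, f n = (∑' m, f (5 * m)) + (∑' m, f (5 * m + 1)) + (∑' m, f (5 * m + 2)) +
      (∑' m, f (5 * m + 3)) + ∑' m, f (5 * m + 4) := by
  have e := (Nat.divModEquiv 5).symm.tsum_eq f
  have hs := (Nat.divModEquiv 5).symm.summable_iff.2 hf
  rw [← e, ← (Equiv.prodComm _ _).tsum_eq, Summable.tsum_prod, tsum_fintype, Fin.sum_univ_five]
  · simp [Nat.divModEquiv, mul_comm]
  · exact (Equiv.prodComm _ _).summable_iff.2 hs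

theorem theta_quotient_eq {s : ℂ} (hs0 : s ≠ 0) (hs : ‖s‖ < 1) :
    theta 1 0 s = 2 * theta 1 1 s * (eulerE 4 (-s) / eulerE 1 (-s)) := by
  have h1 := theta_one_one_mul_eulerE hs0 hs
  have h2 := theta_one_zero_mul_eulerE hs0 hs
  have h3 := eulerE_one_neg hs
  have h4 : eulerE 4 (-s) = eulerE 4 s := by simp [eulerE, Even.neg_pow (by decide : Even 4)]
  have e1 := eulerE_ne_zero hs one_ne_zero
  have e2 := eulerE_ne_zero hs two_ne_zero
  have e4 := eulerE_ne_zero hs four_ne_zero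
  rw [← eq_div_iff (by positivity)] at h1 h2 h3
  rw [h1, h2, h3, h4]
  field_simp

/-- The component in the residue class `3` modulo `5` of the generating function of 4-regular
partitions, in terms of theta functions. -/
theorem tsum_numRegularPartitions_eq_theta {q y : ℂ} (hqy : y = -q) (hq0 : q ≠ 0) (hq : ‖q‖ < 1)
    {A B C P Q R φ₂ ψ₂ : ℂ}
    (hA : A = theta 5 5 y) (hB : B = theta 3 7 y) (hC : C = theta 1 9 y)
    (hP : P = theta 2 3 y) (hQ : Q = theta 1 4 y) (hR : 2 * R = theta 5 0 y)
    (hφ : φ₂ = theta 1 1 y ^ 2) (hψ : 4 * ψ₂ = theta 1 0 y ^ 2)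
    (hB0 : B ≠ 0) (hC0 : C ≠ 0) :
    (∑' n : ℕ, (numRegularPartitions 4 (5 * n + 3) : ℂ) * q ^ n) * (A * φ₂ * ψ₂) =
      R * (3 * A ^ 2 * (P * Q) + q * A ^ 2 * R ^ 2 + 4 * q ^ 2 * R ^ 2 * (B * C)) := by
  have hy0 : y ≠ 0 := by rwa [hqy, neg_ne_zero]
  have hy : ‖y‖ < 1 := by rwa [hqy, norm_neg]
  have hroot : ∀ s : ℂ, s ^ 5 = y → s ≠ 0 ∧ ‖s‖ < 1 := fun s hs => by
    constructor
    · rintro rfl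
      exact hy0 (by simpa using hs.symm)
    · rw [← hs, norm_pow] at hy
      exact (pow_lt_one_iff_of_nonneg (norm_nonneg s) (by norm_num)).1 hy
  have hφs : ∀ s : ℂ, s ^ 5 = y → theta 1 1 s = A + 2 * s * B + 2 * s ^ 4 * C := fun s hs => by
    rw [theta_one_one_dissection (hroot s hs).1 (hroot s hs).2, hs, hA, hB, hC]
  have hψs : ∀ s : ℂ, s ^ 5 = y → theta 1 0 s = 2 * (P + s * Q + s ^ 3 * R) := fun s hs => by
    rw [theta_one_zero_dissection (hroot s hs).1 (hroot s hs).2, hs, hP, hQ, ← hR]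
    ring
  have hnorm : dissectionNorm y A B C ≠ 0 := dissectionNorm_ne_zero fun s hs h0 => by
    -- The product formula shows that `φ` has no zero in the punctured disc.
    have := theta_one_one_mul_eulerE (hroot s hs).1 (hroot s hs).2
    rw [hφs s hs, h0, zero_mul] at this
    exact pow_ne_zero 5 (eulerE_ne_zero (hroot s hs).2 two_ne_zero) this.symm
  obtain ⟨G, hG⟩ : ∃ G : ℕ → ℂ, ∀ j,
      G j = ∑' n : ℕ, (numRegularPartitions 4 (5 * n + j) : ℂ) * q ^ n := ⟨_, fun _ => rfl⟩
  have hF : ∀ s : ℂ, s ^ 5 = y → eulerE 4 (-s) / eulerE 1 (-s) =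
      G 0 - s * G 1 + s ^ 2 * G 2 - s ^ 3 * G 3 + s ^ 4 * G 4 := by
    intro s hs
    have h := hasSum_numRegularPartitions four_ne_zero (z := -s) (by simpa using (hroot s hs).2)
    have hj : ∀ j : ℕ, ∑' m : ℕ, (numRegularPartitions 4 (5 * m + j) : ℂ) * (-s) ^ (5 * m + j) =
        (-s) ^ j * G j := by
      intro j
      rw [hG, ← tsum_mul_left]
      refine tsum_congr fun m => ?_
      have : (-s) ^ 5 = q := by
        rw [Odd.neg_pow (by decide), hs, hqy, neg_neg]
      rw [pow_add, pow_mul, this]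
      ring
    rw [← h.tsum_eq, tsum_nat_eq_sum_mod_five h.summable, hj 1, hj 2, hj 3, hj 4]
    have := hj 0
    simp only [add_zero, pow_zero, one_mul] at this
    rw [this]
    ring
  -- The unknowns are `(-1)^j G j`, since `F` is evaluated at `-s`.
  obtain ⟨e₀, e₁, e₂, e₃, e₄⟩ := coeff_eq_zero_of_fifth_roots hy0
    (c₀ := A * G 0 + 2 * y * B * G 4 + 2 * y * C * -G 1 - P)
    (c₁ := A * -G 1 + 2 * B * G 0 + 2 * y * C * G 2 - Q)
    (c₂ := A * G 2 + 2 * B * -G 1 + 2 * y * C * -G 3)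
    (c₃ := A * -G 3 + 2 * B * G 2 + 2 * y * C * G 4 - R)
    (c₄ := A * G 4 + 2 * B * -G 3 + 2 * C * G 0) (fun s hs => by
      have h := theta_quotient_eq (hroot s hs).1 (hroot s hs).2
      rw [hφs s hs, hψs s hs, hF s hs] at h
      linear_combination -h / 2 + (-2 * B * G 4 + 2 * C * G 1 - 2 * s * C * G 2 +
        2 * s ^ 2 * C * G 3 - 2 * s ^ 3 * C * G 4) * hs)
  have hcoef := dissection_coefficient (sub_eq_zero.1 e₀) (sub_eq_zero.1 e₁) e₂ (sub_eq_zero.1 e₃) e₄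
  obtain ⟨h₁, h₂, h₃⟩ := theta_relations hy0 hy hA hB hC hP hQ hR
  have key := dissection_identity hB0 hC0 h₁ h₂ h₃
  have hφ' : φ₂ = A ^ 2 + 4 * y * (B * C) := by
    rw [hφ, theta_one_one_sq hy0 hy, hA, hB, hC]
  have hψ' : ψ₂ = P * Q + y * R ^ 2 := by
    have := theta_one_zero_sq hy0 hy
    rw [← hψ, ← hP, ← hQ, ← hR] at this
    linear_combination this / 4
  rw [← hcoef] at key
  rw [← hG 3, hφ', hψ']
  apply mul_left_cancel₀ hnorm
  obtain rfl : q = -y := by rw [hqy, neg_neg]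
  linear_combination -key

/-- Needed only at `q = 0`, which the theta series with integer exponents exclude. -/
theorem numRegularPartitions_four_three : numRegularPartitions 4 3 = 3 := by
  have hinj : Function.Injective (Nat.Partition.parts (n := 3)) := fun p p' h => Nat.Partition.ext h
  have h : (Nat.Partition.restricted 3 (fun i => ¬ 4 ∣ i)).image Nat.Partition.parts =
      {{3}, {2, 1}, {1, 1, 1}} := by
    ext s
    simp only [Finset.mem_image, Nat.Partition.restricted, Finset.mem_filter, Finset.mem_univ,
      true_and, Finset.mem_insert, Finset.mem_singleton]
    constructor
    · rintro ⟨⟨s, hpos, hsum⟩, -, rfl⟩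
      obtain ⟨l, rfl⟩ : ∃ l : List ℕ, s = l := ⟨s.toList, s.coe_toList.symm⟩
      rcases l with _ | ⟨a, _ | ⟨b, _ | ⟨c, _ | ⟨d, l⟩⟩⟩⟩
      · simp at hsum
      · left
        simp at hsum
        simp [hsum]
      · right
        left
        have ha := @hpos a (by simp)
        have hb := @hpos b (by simp)
        simp at hsum
        obtain ⟨rfl, rfl⟩ | ⟨rfl, rfl⟩ : (a = 1 ∧ b = 2) ∨ (a = 2 ∧ b = 1) := by omega
        · exact Multiset.coe_eq_coe.2 (by decide)
        · exact Multiset.coe_eq_coe.2 (by decide)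
      · right
        right
        have ha := @hpos a (by simp)
        have hb := @hpos b (by simp)
        have hc := @hpos c (by simp)
        simp at hsum
        obtain ⟨rfl, rfl, rfl⟩ : a = 1 ∧ b = 1 ∧ c = 1 := by omega
        rfl
      · have ha := @hpos a (by simp)
        have hb := @hpos b (by simp)
        have hc := @hpos c (by simp)
        have hd := @hpos d (by simp)
        simp at hsum
        omega
    · rintro (rfl | rfl | rfl)
      · exact ⟨⟨{3}, by decide, rfl⟩, by decide, rfl⟩
      · exact ⟨⟨{2, 1}, by decide, rfl⟩, by decide, rfl⟩
      · exact ⟨⟨{1, 1, 1}, by decide, rfl⟩, by decide, rfl⟩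
  rw [numRegularPartitions, ← Finset.card_image_of_injective _ hinj, h]
  decide

theorem theorem3 (q : ℂ) (hq : ‖q‖ < 1) :
    HasSum (fun n : ℕ => (numRegularPartitions 4 (5 * n + 3) : ℂ) * q ^ n)
      (3 * (eulerE 2 q ^ 2 * eulerE 10 q ^ 6) /
          (eulerE 1 q ^ 5 * eulerE 4 q * eulerE 20 q ^ 2)
        + q * (eulerE 2 q ^ 4 * eulerE 5 q ^ 5 * eulerE 20 q ^ 3) /
          (eulerE 1 q ^ 6 * eulerE 4 q ^ 2 * eulerE 10 q ^ 4)
        + 4 * q ^ 2 * (eulerE 2 q ^ 3 * eulerE 10 q * eulerE 20 q ^ 3) /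
          (eulerE 1 q ^ 5 * eulerE 4 q ^ 2)) := by
  rcases eq_or_ne q 0 with rfl | hq0
  · have hE : ∀ n : ℕ, n ≠ 0 → eulerE n 0 = 1 := fun n hn => by
      simp [eulerE, qProd, hn]
    convert hasSum_single 0 fun n hn => ?_ using 1
    · simp [hE, numRegularPartitions_four_three]
    · simp [hn]
  have hs : Summable fun n : ℕ => (numRegularPartitions 4 (5 * n + 3) : ℂ) * q ^ n := by
    -- With `t⁵ = q` the series is, up to the factor `t³`, a subseries of the generating function at
    -- `t`.
    obtain ⟨t, ht⟩ := IsAlgClosed.exists_pow_nat_eq q (n := 5) (by norm_num)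
    have ht0 : t ≠ 0 := by
      rintro rfl
      exact hq0 (by simpa using ht.symm)
    have ht1 : ‖t‖ < 1 := by
      rw [← ht, norm_pow] at hq
      exact (pow_lt_one_iff_of_nonneg (norm_nonneg t) (by norm_num)).1 hq
    have h := (hasSum_numRegularPartitions four_ne_zero ht1).summable.comp_injective
      (i := fun n : ℕ => 5 * n + 3) fun a b hab => by simpa using hab
    refine (h.mul_right ((t ^ 3)⁻¹)).congr fun n => ?_
    simp only [Function.comp]
    rw [pow_add, pow_mul, ht]
    field_simp
  obtain ⟨y, hqy⟩ : ∃ y, y = -q := ⟨_, rfl⟩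
  have hy0 : y ≠ 0 := by rwa [hqy, neg_ne_zero]
  have hy : ‖y‖ < 1 := by rwa [hqy, norm_neg]
  have hq5 : ‖q ^ 5‖ < 1 := norm_pow_lt_one hq (by norm_num)
  have hy5 : ‖y ^ 5‖ < 1 := norm_pow_lt_one hy (by norm_num)
  have E1 := eulerE_ne_zero hq one_ne_zero
  have E2 := eulerE_ne_zero hq two_ne_zero
  have E4 := eulerE_ne_zero hq four_ne_zero
  have E5 := eulerE_ne_zero hq (n := 5) (by norm_num)
  have E10 := eulerE_ne_zero hq (n := 10) (by norm_num)
  have E20 := eulerE_ne_zero hq (n := 20) (by norm_num)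
  -- Passing from `y = -q` back to `q` fixes the even-index Euler products; `E₁` and `E₅` change by
  -- `eulerE_one_neg`.
  have y2 : eulerE 2 y = eulerE 2 q := by simp [hqy, eulerE, Even.neg_pow (by decide : Even 2)]
  have y4 : eulerE 4 y = eulerE 4 q := by simp [hqy, eulerE, Even.neg_pow (by decide : Even 4)]
  have y10 : eulerE 10 y = eulerE 10 q := by
    simp [hqy, eulerE, Even.neg_pow (by decide : Even 10)]
  have y20 : eulerE 20 y = eulerE 20 q := by
    simp [hqy, eulerE, Even.neg_pow (by decide : Even 20)]
  have y1 : eulerE 1 y = eulerE 2 q ^ 3 / (eulerE 1 q * eulerE 4 q) := by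
    rw [eq_div_iff (by positivity), hqy]
    exact eulerE_one_neg hq
  have y5 : eulerE 5 y = eulerE 10 q ^ 3 / (eulerE 5 q * eulerE 20 q) := by
    have h := eulerE_one_neg hq5
    rw [← Odd.neg_pow (by decide), ← hqy] at h
    simp only [eulerE_pow] at h
    rw [eq_div_iff (by positivity)]
    exact h
  have tφ : theta 1 1 y = eulerE 1 q ^ 2 / eulerE 2 q := by
    have h := theta_one_one_mul_eulerE hy0 hy
    rw [y1, y2, y4] at h
    field_simp at h ⊢
    linear_combination h
  have tψ : theta 1 0 y = 2 * (eulerE 1 q * eulerE 4 q / eulerE 2 q) := by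
    have h := theta_one_zero_mul_eulerE hy0 hy
    rw [y1, y2] at h
    field_simp at h ⊢
    linear_combination h
  have tA : theta 5 5 y = eulerE 5 q ^ 2 / eulerE 10 q := by
    have h := theta_one_one_mul_eulerE (pow_ne_zero 5 hy0) hy5
    simp only [eulerE_pow, theta_pow] at h
    norm_num [y5, y10, y20] at h
    field_simp at h ⊢
    linear_combination h
  have tR : theta 5 0 y = 2 * (eulerE 5 q * eulerE 20 q / eulerE 10 q) := by
    have h := theta_one_zero_mul_eulerE (pow_ne_zero 5 hy0) hy5
    simp only [eulerE_pow, theta_pow] at h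
    norm_num [y5, y10] at h
    field_simp at h ⊢
    linear_combination h
  have tBC : theta 3 7 y * theta 1 9 y =
      eulerE 1 q * eulerE 10 q ^ 3 / (eulerE 2 q * eulerE 5 q) := by
    have h := theta_three_seven_mul_theta_one_nine hy0 hy
    rw [y1, y2, y4, y5, y20] at h
    field_simp at h ⊢
    linear_combination h
  have tPQ : theta 2 3 y * theta 1 4 y =
      eulerE 1 q * eulerE 4 q * eulerE 10 q ^ 8 /
        (eulerE 2 q ^ 2 * eulerE 5 q ^ 3 * eulerE 20 q ^ 3) := by
    have h := theta_two_three_mul_theta_one_four hy0 hy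
    rw [y1, y2, y5, y10] at h
    field_simp at h ⊢
    linear_combination h
  have hBC0 : theta 3 7 y * theta 1 9 y ≠ 0 := by
    rw [tBC]
    positivity
  have main := tsum_numRegularPartitions_eq_theta hqy hq0 hq rfl rfl rfl rfl rfl tR.symm rfl
    (ψ₂ := (eulerE 1 q * eulerE 4 q / eulerE 2 q) ^ 2) (by rw [tψ]; ring)
    (left_ne_zero_of_mul hBC0) (right_ne_zero_of_mul hBC0)
  rw [tBC, tPQ, tA, tφ, ← eq_div_iff (by positivity)] at main
  convert hs.hasSum using 1
  rw [main]
  field_simp
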